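/- **Setting.** Let $d,n,m\in\mathbb N$ be positive, $r>0$, and $\Omega=\bigcup_{x\in S}B_r(x)\subset\mathbb R^d$ with $S$ bounded and $B_r(x)$ the open Euclidean ball. For $u$ that is $m$ times differentiable on $\Omega$ put $|u|_{\Omega,m}=\max_{|\alpha|=m}\sup_{x\in\Omega}|\partial^\alpha u(x)|$. Let $x_1,\dots,x_n\in\Omega$ be distinct points with fill distance $h=\sup_{x\in\Omega}\min_{i}\|x-x_i\|$. Let $\mathcal H$ be a real reproducing kernel Hilbert space of functions on $\Omega$ with kernel $k$ and $\phi(x)=k(x,\cdot)$, and let $\mathsf M,\mathsf D_m\ge 1$ be such that: (a) $w|_\Omega\in\mathcal H$ for all $w\in C^\infty(\mathbb R^d)$, and for all $u,v\in\mathcal H$ one has $u\cdot v\in\mathcal H$ and $\|u\cdot v\|_{\mathcal H}\le \mathsf M\|u\|_{\mathcal H}\|v\|_{\mathcal H}$; (b) $a\circ(v_1,\dots,v_p)\in\mathcal H$ for all $p$, all $a\in C^\infty(\mathbb R^p)$ and $v_1,\dots,v_p\in\mathcal H$; (c) for every ball $B_\rho(z)\subset\Omega$ and $u\in\mathcal H$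 there is $g\in\mathcal H$ with $g(x)=\int_0^1(1-t)\,u(z+t(x-z))\,dt$ for all $x\in B_\rho(z)$; (d) the derivatives $\partial_x^\alpha\partial_y^\alpha k$ exist and are continuous on $\Omega\times\Omega$ for $|\alpha|\le m$, and $|\partial_x^\alpha\partial_y^\alpha k(x,y)|\le \mathsf D_m^2$ for $|\alpha|=m$ and $x,y\in\Omega$. Let $f\in C^2(\mathbb R^d)$ be such that the set $Z$ of global minimizers of $f$ lying in $\Omega$ is nonempty and finite, the Hessian of $f$ is positive definite at each point of $Z$, no global minimizer of $f$ lies on $\partial\Omega$, and $f|_\Omega\in\mathcal H$, $\frac{\partial^2 f}{\partial x_i\partial x_j}\big|_\Omega\in\mathcal H$ for all $i,j$. Put $f_*=\min_{x\in\mathbb R^d} f(x)$. Consider the problem $$\max_{c\in\mathbb R,\ A\in\mathbb S_+(\mathcal H)} c\quad\text{such that}\quad f(x)-c=\langle\phi(x),A\phi(x)\rangle\ \ \forall x\in\Omega,\tag{1}$$ where $\mathbb S_+(\mathcal H)$ is the set of bounded self-adjoint positive semidefinite operators, and, for $\lambda>0$, the semidefinite program $$\max_{c\in\mathbb R,\ B\in\mathbb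 S_+(\mathbb R^n)} c-\lambda\operatorname{tr}(B)\quad\text{such that}\quad f(x_i)-c=\Phi_i^\top B\,\Phi_i,\ \ i=1,\dots,n,\tag{2}$$ where $\Phi_i$ is the $i$-th column of the upper triangular Cholesky factor $R$ of $K=(k(x_i,x_j))_{i,j}=R^\top R$. **Theorem.** Problem (1) has a solution $(f_*,A_*)$ with $A_*$ of finite trace and of rank at most $d|Z|+1$. The Cholesky factor $R$ exists, and problem (2) has a solution for every $\lambda>0$. Let $$C_0=3\,\frac{\max\bigl(\sqrt d,\,3\sqrt{2d}\,(m-1)\bigr)^{2m}}{m!},\qquad \eta=C_0h^m .$$ If $h\le r\min\bigl(1,\frac1{18(m-1)^2}\bigr)$ (read as $h\le r$ when $m=1$) and $\lambda>0$, $\lambda\ge 2\,\mathsf M\,\mathsf D_m\,\eta$, then for every solution $(\hat c,\hat B)$ of (2) and every operator $A_*$ of finite trace that solves (1), $$|\hat c-f_*|\le 2\eta\,|f|_{\Omega,m}+\lambda\operatorname{tr}(A_*),\qquad \operatorname{tr}(\hat B)\le 2\operatorname{tr}(A_*)+2\frac{\eta}{\lambda}\,|f|_{\Omega,m}.$$ 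-/

import Mathlib

open scoped RealInnerProductSpace ContDiff Nat
open MeasureTheory

namespace KernelSOS

noncomputable section

/-- The partial derivative of `u` at `x` in the coordinate directions `I 0, …, I (m - 1)`. As `I`
ranges over `Fin m → Fin d` these are the derivatives `∂^α u (x)` with `|α| = m`. -/
def partialDeriv {d m : ℕ} (I : Fin m → Fin d) (u : EuclideanSpace ℝ (Fin d) → ℝ)
    (x : EuclideanSpace ℝ (Fin d)) : ℝ :=
  iteratedFDeriv ℝ m u x (fun j => EuclideanSpace.single (I j) (1 : ℝ))

/-- The seminorm `|u|_{Ω,m} = max_{|α| = m} sup_{x ∈ Ω} |∂^α u (x)|`. -/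
def seminormOn {d : ℕ} (Ω : Set (EuclideanSpace ℝ (Fin d))) (m : ℕ)
    (u : EuclideanSpace ℝ (Fin d) → ℝ) : ℝ :=
  ⨆ I : Fin m → Fin d, ⨆ x : Ω, |partialDeriv I u x|

/-- The Hessian matrix of `u` at `x`. -/
def hessian {d : ℕ} (u : EuclideanSpace ℝ (Fin d) → ℝ) (x : EuclideanSpace ℝ (Fin d)) :
    Matrix (Fin d) (Fin d) ℝ :=
  Matrix.of fun i j => partialDeriv ![i, j] u x

/-- The fill distance `sup_{z ∈ Ω} min_i ‖z - x i‖`. -/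
def fillDistance {d n : ℕ} (Ω : Set (EuclideanSpace ℝ (Fin d))) (x : Fin n → Ω) : ℝ :=
  ⨆ z : Ω, ⨅ i : Fin n, ‖(z : EuclideanSpace ℝ (Fin d)) - x i‖

/-- `Ω` is the union of the open balls of radius `r` centred at the points of a bounded set. -/
def IsUnionOfBalls {d : ℕ} (Ω : Set (EuclideanSpace ℝ (Fin d))) (r : ℝ) : Prop :=
  0 < r ∧ ∃ S : Set (EuclideanSpace ℝ (Fin d)),
    Bornology.IsBounded S ∧ Ω = ⋃ x ∈ S, Metric.ball x r

/-- The global minimizers (over all of `ℝ^d`) of `f` that lie in `Ω`. -/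
def minimizersIn {d : ℕ} (Ω : Set (EuclideanSpace ℝ (Fin d)))
    (f : EuclideanSpace ℝ (Fin d) → ℝ) : Set (EuclideanSpace ℝ (Fin d)) :=
  {z | z ∈ Ω ∧ ∀ x, f z ≤ f x}

/-- The geometric conditions on `f` relative to `Ω`. (Finitely many points are isolated.) -/
structure IsGeometric {d : ℕ} (Ω : Set (EuclideanSpace ℝ (Fin d)))
    (f : EuclideanSpace ℝ (Fin d) → ℝ) : Prop where
  contDiff : ContDiff ℝ 2 f
  nonempty : (minimizersIn Ω f).Nonempty
  finite : (minimizersIn Ω f).Finite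
  hessian_posDef : ∀ z ∈ minimizersIn Ω f, (hessian f z).PosDef
  frontier : ∀ z ∈ frontier Ω, ¬ ∀ x, f z ≤ f x

/-- Extension by zero to `ℝ^d` of a function on `Ω`. It serves only to write derivatives at points
of the open set `Ω` and integrals along segments contained in `Ω`. -/
def zeroExt {d : ℕ} {Ω : Set (EuclideanSpace ℝ (Fin d))} (u : Ω → ℝ) :
    EuclideanSpace ℝ (Fin d) → ℝ :=
  Function.extend Subtype.val u 0

/-- `diagPartial [i₁, …, i_l] k` is the derivative `∂_x^α ∂_y^α k` of `k (x, y)`, where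
`α = e_{i₁} + ⋯ + e_{i_l}`. -/
def diagPartial {d : ℕ} :
    List (Fin d) → (EuclideanSpace ℝ (Fin d) → EuclideanSpace ℝ (Fin d) → ℝ) →
      EuclideanSpace ℝ (Fin d) → EuclideanSpace ℝ (Fin d) → ℝ
  | [], k => k
  | i :: l, k => fun x y =>
      lineDeriv ℝ
        (fun x' => lineDeriv ℝ (fun y' => diagPartial l k x' y') y (EuclideanSpace.single i 1))
        x (EuclideanSpace.single i 1)

/-- `k` is `m` times continuously differentiable on `Ω × Ω` as a kernel: the derivatives
`∂_x^α ∂_y^α k` with `|α| ≤ m` exist and are continuous on `Ω × Ω`. -/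
structure IsDiffKernelOn {d : ℕ} (Ω : Set (EuclideanSpace ℝ (Fin d))) (m : ℕ)
    (k : EuclideanSpace ℝ (Fin d) → EuclideanSpace ℝ (Fin d) → ℝ) : Prop where
  differentiable_right : ∀ (l : List (Fin d)) (i : Fin d), l.length < m → ∀ x ∈ Ω, ∀ y ∈ Ω,
    LineDifferentiableAt ℝ (fun y' => diagPartial l k x y') y (EuclideanSpace.single i 1)
  differentiable_left : ∀ (l : List (Fin d)) (i : Fin d), l.length < m → ∀ x ∈ Ω, ∀ y ∈ Ω,
    LineDifferentiableAt ℝ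
      (fun x' => lineDeriv ℝ (fun y' => diagPartial l k x' y') y (EuclideanSpace.single i 1))
      x (EuclideanSpace.single i 1)
  continuousOn : ∀ l : List (Fin d), l.length ≤ m →
    ContinuousOn (fun p : EuclideanSpace ℝ (Fin d) × EuclideanSpace ℝ (Fin d) =>
      diagPartial l k p.1 p.2) (Ω ×ˢ Ω)

section RKHSpart

variable {d : ℕ} {Ω : Set (EuclideanSpace ℝ (Fin d))}
  (H : Type*) [NormedAddCommGroup H] [InnerProductSpace ℝ H] [CompleteSpace H] [RKHS ℝ H Ω ℝ]

/-- The canonical feature map `φ x = k (x, ·)` of the reproducing kernel Hilbert space `H`. -/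
def feature (x : Ω) : H := RKHS.kerFun H x (1 : ℝ)

/-- The real-valued reproducing kernel of `H`. -/
def kern (x y : Ω) : ℝ := RKHS.kernel H x y (1 : ℝ)

theorem kern_eq_inner (x y : Ω) : kern H x y = ⟪feature H x, feature H y⟫ := by
  have h := RKHS.kernel_inner H x y (1 : ℝ) (1 : ℝ)
  rw [real_inner_comm, real_inner_comm (RKHS.kerFun H x (1 : ℝ))] at h
  simpa [kern, feature, -RKHS.kerFun_inner, -RKHS.inner_kerFun] using h

theorem inner_feature (u : H) (x : Ω) : ⟪u, feature H x⟫ = u x := by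
  simp [feature]

/-- The conditions on the function space `H` (a reproducing kernel Hilbert space on `Ω`), with
smoothness order `m` and constants `M` and `D`. -/
structure IsRich (m : ℕ) (M D : ℝ) : Prop where
  one_le_M : 1 ≤ M
  one_le_D : 1 ≤ D
  smooth_mem : ∀ w : EuclideanSpace ℝ (Fin d) → ℝ, ContDiff ℝ ∞ w →
    ∃ u : H, ∀ x : Ω, u x = w x
  mul_mem : ∀ u v : H, ∃ w : H, (∀ x : Ω, w x = u x * v x) ∧ ‖w‖ ≤ M * ‖u‖ * ‖v‖
  comp_mem : ∀ (p : ℕ) (a : (Fin p → ℝ) → ℝ), ContDiff ℝ ∞ a → ∀ v : Fin p → H,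
    ∃ u : H, ∀ x : Ω, u x = a (fun j => v j x)
  integral_mem : ∀ (z : EuclideanSpace ℝ (Fin d)) (ρ : ℝ), 0 < ρ → Metric.ball z ρ ⊆ Ω →
    ∀ u : H, ∃ g : H, ∀ x : Ω, (x : EuclideanSpace ℝ (Fin d)) ∈ Metric.ball z ρ →
      g x = ∫ t in (0 : ℝ)..1,
        (1 - t) * zeroExt (u : Ω → ℝ) (z + t • ((x : EuclideanSpace ℝ (Fin d)) - z))
  kernel_diff : IsDiffKernelOn Ω m (fun x y => zeroExt (fun x' => zeroExt (kern H x') y) x)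
  kernel_bound : ∀ l : List (Fin d), l.length = m → ∀ x ∈ Ω, ∀ y ∈ Ω,
    |diagPartial l (fun x y => zeroExt (fun x' => zeroExt (kern H x') y) x) x y| ≤ D ^ 2

/-- `f` and all its second partial derivatives, restricted to `Ω`, belong to `H`. -/
structure IsAnalyticFor (f : EuclideanSpace ℝ (Fin d) → ℝ) : Prop where
  contDiffOn : ContDiffOn ℝ 2 f Ω
  mem : ∃ u : H, ∀ x : Ω, u x = f x
  partial_mem : ∀ i j : Fin d, ∃ u : H, ∀ x : Ω, u x = partialDeriv ![i, j] f x

/-- `(c, A)` is feasible for the problem: maximize `c` over `c ∈ ℝ` and bounded positive operators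
`A` on `H` subject to `f x - c = ⟪φ x, A (φ x)⟫` for all `x ∈ Ω`. -/
def IsFeasible (f : EuclideanSpace ℝ (Fin d) → ℝ) (c : ℝ) (A : H →L[ℝ] H) : Prop :=
  A.IsPositive ∧ ∀ x : Ω, f x - c = ⟪feature H x, A (feature H x)⟫

/-- `(c, A)` solves the infinite-dimensional problem. -/
def IsSolution (f : EuclideanSpace ℝ (Fin d) → ℝ) (c : ℝ) (A : H →L[ℝ] H) : Prop :=
  IsFeasible H f c A ∧ ∀ (c' : ℝ) (A' : H →L[ℝ] H), IsFeasible H f c' A' → c' ≤ c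

/-- The kernel matrix of the points `x 0, …, x (n - 1)`. -/
def kernelMatrix {n : ℕ} (x : Fin n → Ω) : Matrix (Fin n) (Fin n) ℝ :=
  Matrix.of fun i j => kern H (x i) (x j)

end RKHSpart

/-- `R` is the upper triangular Cholesky factor of `K`: `K = Rᵀ R`, with positive diagonal. -/
def IsCholesky {n : ℕ} (K R : Matrix (Fin n) (Fin n) ℝ) : Prop :=
  R.IsUpperTriangular ∧ (∀ i, 0 < R i i) ∧ K = R.transpose * R

/-- `(c, B)` is feasible for the finite semidefinite program with feature vectors `Φ i`, the `i`-th
column of `R`: `B` is positive semidefinite and `f (x i) - c = Φ iᵀ B Φ i` for all `i`. -/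
def IsSDPFeasible {d n : ℕ} {Ω : Set (EuclideanSpace ℝ (Fin d))}
    (f : EuclideanSpace ℝ (Fin d) → ℝ) (x : Fin n → Ω) (R : Matrix (Fin n) (Fin n) ℝ)
    (c : ℝ) (B : Matrix (Fin n) (Fin n) ℝ) : Prop :=
  B.PosSemidef ∧ ∀ i, f (x i) - c = R.col i ⬝ᵥ B.mulVec (R.col i)

/-- `(c, B)` maximizes `c - lam * tr B` over the feasible pairs. -/
def IsSDPSolution {d n : ℕ} {Ω : Set (EuclideanSpace ℝ (Fin d))}
    (f : EuclideanSpace ℝ (Fin d) → ℝ) (x : Fin n → Ω) (R : Matrix (Fin n) (Fin n) ℝ)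
    (lam c : ℝ) (B : Matrix (Fin n) (Fin n) ℝ) : Prop :=
  IsSDPFeasible f x R c B ∧ ∀ (c' : ℝ) (B' : Matrix (Fin n) (Fin n) ℝ),
    IsSDPFeasible f x R c' B' → c' - lam * B'.trace ≤ c - lam * B.trace

/-- A Bessel-type bound behind the independence of the trace from the basis. -/
theorem sum_inner_le_of_orthonormal {H : Type*} [NormedAddCommGroup H] [InnerProductSpace ℝ H]
    [CompleteSpace H] {ι κ : Type*} (b : HilbertBasis ι ℝ H) {A : H →L[ℝ] H} (hA : A.IsPositive)
    {s : ℝ} (hs : HasSum (fun i => ⟪b i, A (b i)⟫) s) {v : κ → H} (hv : Orthonormal ℝ v)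
    (G : Finset κ) : ∑ j ∈ G, ⟪v j, A (v j)⟫ ≤ s := by
  classical
  have key : ∀ F : Finset ι,
      ∑ j ∈ G, ⟪∑ i ∈ F, ⟪b i, v j⟫ • b i, A (∑ i ∈ F, ⟪b i, v j⟫ • b i)⟫ ≤ s := by
    intro F
    have expand : ∀ y : F → ℝ, ⟪∑ i : F, y i • b i, A (∑ i : F, y i • b i)⟫
        = ∑ i : F, ∑ k : F, y i * y k * ⟪b i, A (b k)⟫ := by
      intro y
      rw [map_sum, sum_inner]
      refine Finset.sum_congr rfl fun i _ => ?_
      rw [inner_sum]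
      refine Finset.sum_congr rfl fun k _ => ?_
      rw [map_smul, inner_smul_left, inner_smul_right, RCLike.conj_to_real]
      ring
    have hps : (Matrix.of fun i k : F => ⟪b i, A (b k)⟫).PosSemidef := by
      refine Matrix.PosSemidef.of_dotProduct_mulVec_nonneg ?_ ?_
      · ext i k
        simp only [Matrix.conjTranspose_apply, Matrix.of_apply, star_trivial]
        rw [real_inner_comm]
        exact hA.isSymmetric _ _
      · intro y
        have h0 := hA.inner_nonneg_right (∑ i : F, y i • b i)
        rw [expand] at h0
        refine h0.trans_eq ?_
        simp only [dotProduct, Matrix.mulVec, Matrix.of_apply, star_trivial, Finset.mul_sum]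
        refine Finset.sum_congr rfl fun i _ => Finset.sum_congr rfl fun k _ => ?_
        ring
    obtain ⟨p, a, ha⟩ := Matrix.posSemidef_iff_eq_sum_vecMulVec.mp hps
    have hent : ∀ i k : F, ⟪b i, A (b k)⟫ = ∑ l, a l i * a l k := by
      intro i k
      have := congrFun (congrFun ha i) k
      simpa [Matrix.sum_apply, Matrix.vecMulVec_apply] using this
    have hb : Orthonormal ℝ (fun i : F => b i) := b.orthonormal.comp _ Subtype.val_injective
    have step : ∀ j, ⟪∑ i ∈ F, ⟪b i, v j⟫ • b i, A (∑ i ∈ F, ⟪b i, v j⟫ • b i)⟫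
        = ∑ l, ‖⟪v j, ∑ i : F, a l i • b i⟫‖ ^ 2 := by
      intro j
      rw [← Finset.sum_coe_sort F, expand (fun i : F => ⟪b i, v j⟫)]
      simp only [hent, Real.norm_eq_abs, sq_abs, inner_sum, inner_smul_right]
      simp only [sq, Finset.sum_mul_sum]
      simp only [Finset.mul_sum]
      rw [Finset.sum_congr rfl fun i _ => Finset.sum_comm, Finset.sum_comm]
      refine Finset.sum_congr rfl fun l _ => Finset.sum_congr rfl fun i _ =>
        Finset.sum_congr rfl fun k _ => ?_
      rw [real_inner_comm (b i), real_inner_comm (b k)]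
      ring
    calc _ = ∑ j ∈ G, ∑ l, ‖⟪v j, ∑ i : F, a l i • b i⟫‖ ^ 2 := Finset.sum_congr rfl fun j _ => step j
      _ = ∑ l, ∑ j ∈ G, ‖⟪v j, ∑ i : F, a l i • b i⟫‖ ^ 2 := Finset.sum_comm
      _ ≤ ∑ l, ‖∑ i : F, a l i • b i‖ ^ 2 :=
          Finset.sum_le_sum fun l _ => hv.sum_inner_products_le _
      _ = ∑ l, ∑ i : F, a l i * a l i := by
          refine Finset.sum_congr rfl fun l _ => ?_
          rw [← real_inner_self_eq_norm_sq, hb.inner_sum]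
          simp
      _ = ∑ i ∈ F, ⟪b i, A (b i)⟫ := by
          rw [Finset.sum_comm, ← Finset.sum_coe_sort F]
          exact Finset.sum_congr rfl fun i _ => (hent i i).symm
      _ ≤ s := sum_le_hasSum F (fun i _ => hA.inner_nonneg_right _) hs
  have hlim : Filter.Tendsto (fun F : Finset ι =>
      ∑ j ∈ G, ⟪∑ i ∈ F, ⟪b i, v j⟫ • b i, A (∑ i ∈ F, ⟪b i, v j⟫ • b i)⟫) Filter.atTop
      (nhds (∑ j ∈ G, ⟪v j, A (v j)⟫)) := by
    refine tendsto_finsetSum _ fun j _ => ?_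
    have h : Filter.Tendsto (fun F : Finset ι => ∑ i ∈ F, ⟪b i, v j⟫ • b i) Filter.atTop
        (nhds (v j)) := by
      have := b.hasSum_repr (v j)
      simp only [b.repr_apply_apply] at this
      exact this
    exact h.inner ((A.continuous.tendsto _).comp h)
  exact le_of_tendsto' hlim key

section Trace

variable {H : Type*} [NormedAddCommGroup H] [InnerProductSpace ℝ H] [CompleteSpace H]

variable (H) in
/-- A chosen Hilbert basis of `H`, indexed by the set of its vectors. -/
def someBasis : HilbertBasis (exists_hilbertBasis ℝ H).choose ℝ H :=
  (exists_hilbertBasis ℝ H).choose_spec.choose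

/-- A positive operator has finite trace if its diagonal in a Hilbert basis is summable. -/
def HasFiniteTrace (A : H →L[ℝ] H) : Prop :=
  Summable fun i => ⟪someBasis H i, A (someBasis H i)⟫

/-- The trace of a positive operator with finite trace. -/
def opTrace (A : H →L[ℝ] H) : ℝ := ∑' i, ⟪someBasis H i, A (someBasis H i)⟫

/-- For positive operators, finiteness and value of the trace do not depend on the basis. -/
theorem hasSum_diag_of_hasSum_diag {H : Type*} [NormedAddCommGroup H] [InnerProductSpace ℝ H]
    [CompleteSpace H] {ι κ : Type*} (b : HilbertBasis ι ℝ H) (b' : HilbertBasis κ ℝ H)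
    {A : H →L[ℝ] H} (hA : A.IsPositive) {s : ℝ} (hs : HasSum (fun i => ⟪b i, A (b i)⟫) s) :
    HasSum (fun i => ⟪b' i, A (b' i)⟫) s := by
  have hle := sum_inner_le_of_orthonormal b hA hs b'.orthonormal
  have hsum : Summable fun i => ⟪b' i, A (b' i)⟫ :=
    summable_of_sum_le (fun i => hA.inner_nonneg_right _) hle
  have h1 : ∑' i, ⟪b' i, A (b' i)⟫ ≤ s := hsum.tsum_le_of_sum_le hle
  have h2 : s ≤ ∑' i, ⟪b' i, A (b' i)⟫ :=
    hasSum_le_of_sum_le hs (sum_inner_le_of_orthonormal b' hA hsum.hasSum b.orthonormal)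
  rw [le_antisymm h2 h1]
  exact hsum.hasSum

theorem hasFiniteTrace_iff {ι : Type*} (b : HilbertBasis ι ℝ H) {A : H →L[ℝ] H}
    (hA : A.IsPositive) : HasFiniteTrace A ↔ Summable fun i => ⟪b i, A (b i)⟫ :=
  ⟨fun h => (hasSum_diag_of_hasSum_diag _ b hA h.hasSum).summable,
    fun h => (hasSum_diag_of_hasSum_diag b _ hA h.hasSum).summable⟩

theorem opTrace_eq_tsum {ι : Type*} (b : HilbertBasis ι ℝ H) {A : H →L[ℝ] H}
    (hA : A.IsPositive) (h : HasFiniteTrace A) : opTrace A = ∑' i, ⟪b i, A (b i)⟫ :=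
  (hasSum_diag_of_hasSum_diag _ b hA h.hasSum).tsum_eq.symm

end Trace

/-- `C₀ = 3 max(√d, 3 √(2d) (m - 1))^{2m} / m!`. -/
def constC (d m : ℕ) : ℝ :=
  3 * (max (√(d : ℝ)) (3 * √(2 * (d : ℝ)) * ((m : ℝ) - 1))) ^ (2 * m) / (m ! : ℝ)

end

end KernelSOS

/-!
Exactness. Near a minimizer `z` of `f` in `Ω`, the integral form of Taylor's theorem writes
`f x - f z` as a quadratic form in `x - z` whose coefficients lie in `H` and whose matrix at `z` is
half the Hessian. Near a positive definite matrix a quadratic form in `d` variables is a sum of `d`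
squares of linear forms depending smoothly on the matrix (`exists_smooth_squares`, from a local
square root given by the inverse function theorem), so `f - f z` is locally a sum of `d` squares of
elements of `H` (`exists_local_sum_squares`). Away from the minimizers `f - min f` is bounded below
and its square root is smooth in `f`. Cutoffs `sin θ`, `cos θ` glue these to one sum of squares on
`Ω` (`exists_sum_squares`), and the squares are the rank one terms of an optimal operator.

Sampling. Let `u` be of class `C^m` on `Ω` and vanish at the data sites. On a ball of radius
`max 1 (18 (m - 1)²) h` inside `Ω`, compare `u` with its Taylor polynomial of degree `m - 1` at the
centre. The data sites in this ball determine the polynomial up to a factor `2`: start from a point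
where its modulus is maximal, aim at a data site near it such that the ray stays in the ball for
`18 (m - 1)²` times the distance to the site, and apply Markov's inequality at the endpoint of this
chord, which is an extremal property of Chebyshev polynomials (`IsPolyOnLines.abs_le_of_dense`).
This gives the bound `abs_le_of_vanishing` by `C₀ h^m |u|_{Ω,m}`.

Regularity. The diagonal derivatives of the kernel control the difference quotients of the feature
map, which is therefore of class `C^m` into `H` (`contDiffOn_featureExt`); hence the derivatives of
order `m` of `u ∈ H` are bounded by `D ‖u‖`.

Error bounds. A Cholesky factor contains the coordinates of the features in an orthonormal family.
Compressing an operator to this family yields a feasible matrix of no larger trace, which bounds the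
value of the program from below. Conversely the quadratic form of a feasible `B` extends to a
nonnegative `w ∈ H` with `‖w‖ ≤ M tr B`. Since `f - c - w` vanishes at the data sites, sampling at a
minimizer of `f` bounds `c - min f` by `C₀ h^m (|f|_{Ω,m} + D M tr B)`. Together these two
inequalities give both estimates once the last term is absorbed by `lam tr B`.
-/

namespace KernelSOS

/-! ### Polynomials restricted to lines, and the endpoint Markov inequality -/

open Polynomial in
/-- **Markov's inequality at an endpoint**, from the extremality of Chebyshev polynomials. -/
theorem derivative_eval_left_le_of_abs_le {q : ℝ[X]} {k : ℕ} (hq : q.natDegree ≤ k) {a b N : ℝ}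
    (hab : a < b) (hN : 0 < N) (hqN : ∀ t ∈ Set.Icc a b, |q.eval t| ≤ N) :
    |q.derivative.eval a| ≤ 2 * (k : ℝ) ^ 2 / (b - a) * N := by
  have hba : 0 < b - a := sub_pos.2 hab
  have key : ∀ c : ℝ, |c| = N⁻¹ → -(c * ((b - a) / 2) * q.derivative.eval a) ≤ (k : ℝ) ^ 2 := by
    intro c hc
    set P : ℝ[X] := C c * q.comp (C ((a + b) / 2) - C ((b - a) / 2) * X) with hP
    have hdeg : P.degree ≤ k := by
      refine natDegree_le_iff_degree_le.1 ?_
      refine (natDegree_C_mul_le _ _).trans (natDegree_comp_le.trans ?_)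
      have h1 : (C ((a + b) / 2) - C ((b - a) / 2) * X : ℝ[X]).natDegree ≤ 1 := by
        compute_degree
      calc _ ≤ q.natDegree * 1 := Nat.mul_le_mul_left _ h1
        _ ≤ k := by simpa using hq
    have hbd : ∀ s ∈ Set.Icc (-1 : ℝ) 1, |P.eval s| ≤ 1 := by
      intro s hs
      have hmem : (a + b) / 2 - (b - a) / 2 * s ∈ Set.Icc a b := by
        constructor <;> nlinarith [hs.1, hs.2]
      have := hqN _ hmem
      simp only [hP, eval_mul, eval_C, eval_comp, eval_sub, eval_X, abs_mul, hc]
      rw [inv_mul_le_iff₀ hN]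
      simpa using this
    have h := Chebyshev.eval_iterate_derivative_le_of_forall_abs_le_one (k := 1) le_rfl hdeg hbd
    have e1 : (derivative P).eval 1 = -(c * ((b - a) / 2) * q.derivative.eval a) := by
      simp only [hP, derivative_C_mul, derivative_comp, eval_mul, eval_C, eval_comp, eval_sub,
        eval_X, derivative_sub, derivative_C, derivative_X, mul_one, zero_sub, eval_neg]
      rw [show (a + b) / 2 - (b - a) / 2 = a by ring]
      ring
    simp only [Function.iterate_one] at h
    rw [e1, Chebyshev.T_derivative_eq_U] at h
    simpa [sq] using h
  have h1 := key N⁻¹ (abs_of_pos (inv_pos.2 hN))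
  have h2 := key (-N⁻¹) (by rw [abs_neg, abs_of_pos (inv_pos.2 hN)])
  rw [div_mul_eq_mul_div, le_div_iff₀ hba]
  have e : ∀ X : ℝ, N⁻¹ * ((b - a) / 2) * X * (2 * N) = X * (b - a) := by
    intro X; field_simp
  rcases abs_cases (q.derivative.eval a) with ⟨h, -⟩ | ⟨h, -⟩ <;> rw [h]
  · have := e (q.derivative.eval a)
    nlinarith [mul_le_mul_of_nonneg_right h2 (by positivity : (0:ℝ) ≤ 2 * N)]
  · have := e (q.derivative.eval a)
    nlinarith [mul_le_mul_of_nonneg_right h1 (by positivity : (0:ℝ) ≤ 2 * N)]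

open Polynomial in
/-- A polynomial of degree at most `k` on an interval of length at least `18 k²` whose modulus is
maximal at the left endpoint has lost at most half of its size after one unit of length. -/
theorem abs_eval_zero_le_two_mul {q : ℝ[X]} {k : ℕ} (hq : q.natDegree ≤ k) {L : ℝ}
    (hkL : 18 * (k : ℝ) ^ 2 ≤ L)
    (hmax : ∀ t ∈ Set.Icc 0 L, |q.eval t| ≤ |q.eval 0|) :
    |q.eval 0| ≤ 2 * |q.eval 1| := by
  rcases Nat.eq_zero_or_pos k with rfl | hk
  · rw [Polynomial.eq_C_of_natDegree_le_zero hq]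
    simp only [eval_C]
    linarith [abs_nonneg (q.coeff 0)]
  rcases (abs_nonneg (q.eval 0)).eq_or_lt with h0 | hN
  · rw [← h0]; positivity
  have hk1 : (1 : ℝ) ≤ k := by exact_mod_cast hk
  have hL18 : 18 ≤ L := by nlinarith
  have hder : ∀ t ∈ Set.Icc (0 : ℝ) 1, ‖q.derivative.eval t‖ ≤ |q.eval 0| / 2 := by
    intro t ht
    have h := derivative_eval_left_le_of_abs_le hq (a := t) (b := L) (by linarith [ht.2]) hN
      fun s hs => hmax s ⟨ht.1.trans hs.1, hs.2⟩
    refine h.trans ?_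
    rw [div_mul_eq_mul_div, div_le_iff₀ (by linarith [ht.2])]
    nlinarith [ht.2]
  have hmv := (convex_Icc (0 : ℝ) 1).norm_image_sub_le_of_norm_hasDerivWithin_le
    (fun t _ => (q.hasDerivAt t).hasDerivWithinAt) hder
    (Set.left_mem_Icc.2 zero_le_one) (Set.right_mem_Icc.2 zero_le_one)
  rw [sub_zero, norm_one, mul_one, Real.norm_eq_abs] at hmv
  have := abs_sub_abs_le_abs_sub (q.eval 0) (q.eval 1)
  rw [abs_sub_comm] at this
  linarith

variable {E : Type*} [NormedAddCommGroup E] [NormedSpace ℝ E]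

open Polynomial in
/-- The restrictions of `g` to all parametrized lines are polynomials of degree at most `k`. -/
def IsPolyOnLines (k : ℕ) (g : E → ℝ) : Prop :=
  ∀ a b : E, ∃ q : ℝ[X], q.natDegree ≤ k ∧ ∀ t : ℝ, q.eval t = g (a + t • b)

theorem IsPolyOnLines.const_mul {k : ℕ} {g : E → ℝ} (hg : IsPolyOnLines k g) (c : ℝ) :
    IsPolyOnLines k fun x => c * g x := by
  intro a b
  obtain ⟨q, hq, h⟩ := hg a b
  exact ⟨Polynomial.C c * q, (Polynomial.natDegree_C_mul_le _ _).trans hq, fun t => by simp [h]⟩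

theorem IsPolyOnLines.sum {ι : Type*} {k : ℕ} {g : ι → E → ℝ} (s : Finset ι)
    (hg : ∀ i ∈ s, IsPolyOnLines k (g i)) : IsPolyOnLines k fun x => ∑ i ∈ s, g i x := by
  intro a b
  choose! q hq h using fun i hi => hg i hi a b
  exact ⟨∑ i ∈ s, q i, Polynomial.natDegree_sum_le_of_forall_le _ _ hq, fun t => by
    rw [Polynomial.eval_finsetSum]
    exact Finset.sum_congr rfl fun i hi => h i hi t⟩

theorem isPolyOnLines_multilinear {j k : ℕ} (hjk : j ≤ k)
    (T : ContinuousMultilinearMap ℝ (fun _ : Fin j => E) ℝ) (z : E) :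
    IsPolyOnLines k fun y => T fun _ => y - z := by
  intro a b
  refine ⟨∑ s : Finset (Fin j), Polynomial.C (T (s.piecewise (fun _ => a - z) fun _ => b)) *
    Polynomial.X ^ (sᶜ).card, ?_, ?_⟩
  · refine Polynomial.natDegree_sum_le_of_forall_le _ _ fun s _ => ?_
    refine (Polynomial.natDegree_C_mul_X_pow_le _ _).trans ((Finset.card_le_univ _).trans ?_)
    simpa using hjk
  · intro t
    have h1 : (fun _ : Fin j => a + t • b - z) = (fun _ => a - z) + fun _ => t • b := by
      ext; simp; abel
    beta_reduce
    rw [h1, ContinuousMultilinearMap.map_add_univ, Polynomial.eval_finsetSum]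
    refine Finset.sum_congr rfl fun s _ => ?_
    have h2 : s.piecewise (fun _ => a - z) (fun _ => t • b) =
        (sᶜ).piecewise (fun i => (fun _ : Fin j => t) i • (s.piecewise (fun _ => a - z) fun _ => b) i)
          (s.piecewise (fun _ => a - z) fun _ => b) := by
      ext i
      by_cases hi : i ∈ s <;> simp [hi]
    rw [h2, ContinuousMultilinearMap.map_piecewise_smul]
    simp only [Finset.prod_const, smul_eq_mul, Polynomial.eval_mul, Polynomial.eval_C,
      Polynomial.eval_pow, Polynomial.eval_X]
    exact mul_comm _ _

/-- **Norming sets.** If data sites come within distance `h` of every point of a ball of radius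
`L h` with `L ≥ 18 k²`, then a polynomial of degree at most `k` is bounded on the ball by twice
its maximum over the data sites in the closed ball. -/
theorem IsPolyOnLines.abs_le_of_dense [ProperSpace E] {k : ℕ} {g : E → ℝ}
    (hg : IsPolyOnLines k g)
    (hgc : Continuous g) {L h e : ℝ} (hL : 1 ≤ L) (hkL : 18 * (k : ℝ) ^ 2 ≤ L) (hh : 0 < h)
    {z : E} {Y : Set E} (hY : ∀ w ∈ Metric.ball z (L * h), ∃ y ∈ Y, ‖w - y‖ ≤ h)
    (he : ∀ y ∈ Y, y ∈ Metric.closedBall z (L * h) → |g y| ≤ e) {x : E}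
    (hx : x ∈ Metric.closedBall z (L * h)) : |g x| ≤ 2 * e := by
  have hL0 : 0 < L := by linarith
  have hδ : 0 < L * h := by positivity
  obtain ⟨w, hw, hmax⟩ := (isCompact_closedBall z (L * h)).exists_isMaxOn ⟨x, hx⟩
    hgc.abs.continuousOn
  -- Moving from `w` a fraction `1 / L` of the way to the centre makes room for a data site.
  have hw' : w + L⁻¹ • (z - w) ∈ Metric.ball z (L * h) := by
    have e1 : w + L⁻¹ • (z - w) - z = (1 - L⁻¹) • (w - z) := by module
    rw [mem_ball_iff_norm, e1, norm_smul, Real.norm_of_nonneg (sub_nonneg.2 (inv_le_one_of_one_le₀ hL))]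
    have h1 := mem_closedBall_iff_norm.1 hw
    have h2 : 0 < L⁻¹ := inv_pos.2 hL0
    have h3 : (1 - L⁻¹) * ‖w - z‖ ≤ (1 - L⁻¹) * (L * h) :=
      mul_le_mul_of_nonneg_left h1 (sub_nonneg.2 (inv_le_one_of_one_le₀ hL))
    have h4 : L⁻¹ * (L * h) = h := by field_simp
    nlinarith
  obtain ⟨y, hyY, hy⟩ := hY _ hw'
  -- The ray from `w` through the data site stays in the ball up to parameter `L`.
  have hend : w + L • (y - w) ∈ Metric.closedBall z (L * h) := by
    have e1 : w + L • (y - w) - z = L • (y - (w + L⁻¹ • (z - w))) := by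
      simp only [smul_sub, smul_add, smul_smul, mul_inv_cancel₀ hL0.ne', one_smul]
      abel
    rw [mem_closedBall_iff_norm, e1, norm_smul, Real.norm_of_nonneg hL0.le, norm_sub_rev]
    gcongr
  have hseg : ∀ t ∈ Set.Icc 0 L, w + t • (y - w) ∈ Metric.closedBall z (L * h) := by
    intro t ht
    have := (convex_closedBall z (L * h)).add_smul_sub_mem hw hend (t := t / L)
      ⟨div_nonneg ht.1 hL0.le, (div_le_one hL0).2 ht.2⟩
    rwa [add_sub_cancel_left, smul_smul, div_mul_cancel₀ _ hL0.ne'] at this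
  obtain ⟨q, hq, hqe⟩ := hg w (y - w)
  have h0 : q.eval 0 = g w := by simp [hqe]
  have h1 : q.eval 1 = g y := by simp [hqe]
  have := abs_eval_zero_le_two_mul hq hkL fun t ht => by
    rw [h0, hqe]; exact hmax (hseg t ht)
  rw [h0, h1] at this
  have hyb := hseg 1 ⟨zero_le_one, hL⟩
  rw [one_smul, add_sub_cancel] at hyb
  have h3 := he y hyY hyb
  have h4 : |g x| ≤ |g w| := hmax hx
  linarith

end KernelSOS

namespace KernelSOS

/-! ### Taylor expansion along segments -/

section Segment

variable {E : Type*} [NormedAddCommGroup E] [NormedSpace ℝ E]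

theorem hasDerivAt_iteratedFDeriv_line {u : E → ℝ} {z v : E} {t : ℝ} {j m : ℕ} (hjm : j < m)
    (hu : ContDiffAt ℝ m u (z + t • v)) :
    HasDerivAt (fun s : ℝ => iteratedFDeriv ℝ j u (z + s • v) fun _ => v)
      (iteratedFDeriv ℝ (j + 1) u (z + t • v) fun _ => v) t := by
  have h1 : DifferentiableAt ℝ (iteratedFDeriv ℝ j u) (z + t • v) :=
    hu.differentiableAt_iteratedFDeriv (by exact_mod_cast hjm)
  have h2 : HasDerivAt (fun s : ℝ => z + s • v) v t := by
    simpa using ((hasDerivAt_id t).smul_const v).const_add z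
  have h3 := h1.hasFDerivAt.comp_hasDerivAt t h2
  have h4 := (ContinuousMultilinearMap.apply ℝ (fun _ : Fin j => E) ℝ
    (fun _ => v)).hasFDerivAt.comp_hasDerivAt t h3
  simpa [iteratedFDeriv_succ_apply_left, Function.comp_def, Fin.tail_def] using h4

theorem iteratedDerivWithin_line {u : E → ℝ} {z v : E} {m : ℕ}
    (hu : ∀ t ∈ Set.Icc (0 : ℝ) 1, ContDiffAt ℝ m u (z + t • v)) {j : ℕ} (hj : j ≤ m) :
    ∀ t ∈ Set.Icc (0 : ℝ) 1,
      iteratedDerivWithin j (fun s : ℝ => u (z + s • v)) (Set.Icc 0 1) t =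
        iteratedFDeriv ℝ j u (z + t • v) fun _ => v := by
  induction j with
  | zero => intro t _; simp
  | succ j ih =>
    intro t ht
    rw [iteratedDerivWithin_succ, derivWithin_congr (ih (by omega)) (ih (by omega) t ht)]
    exact (hasDerivAt_iteratedFDeriv_line hj (hu t ht)).hasDerivWithinAt.derivWithin
      (uniqueDiffOn_Icc zero_lt_one t ht)

theorem contDiffOn_line {u : E → ℝ} {z v : E} {m : ℕ}
    (hu : ∀ t ∈ Set.Icc (0 : ℝ) 1, ContDiffAt ℝ m u (z + t • v)) :
    ContDiffOn ℝ m (fun s : ℝ => u (z + s • v)) (Set.Icc 0 1) := fun t ht =>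
  ((hu t ht).comp (g := u) (f := fun s : ℝ => z + s • v) t (by fun_prop)).contDiffWithinAt

/-- The Taylor polynomial of degree less than `m` of `u` at `z`. -/
noncomputable def taylorPoly (u : E → ℝ) (z : E) (m : ℕ) (y : E) : ℝ :=
  ∑ j ∈ Finset.range m, (j ! : ℝ)⁻¹ * iteratedFDeriv ℝ j u z fun _ => y - z

theorem isPolyOnLines_taylorPoly (u : E → ℝ) (z : E) (m : ℕ) :
    IsPolyOnLines (m - 1) (taylorPoly u z m) :=
  IsPolyOnLines.sum _ fun j hj => (isPolyOnLines_multilinear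
    (by have := Finset.mem_range.1 hj; omega) _ _).const_mul _

theorem continuous_taylorPoly (u : E → ℝ) (z : E) (m : ℕ) : Continuous (taylorPoly u z m) := by
  unfold taylorPoly
  refine continuous_finsetSum _ fun j _ => continuous_const.mul ?_
  exact (iteratedFDeriv ℝ j u z).cont.comp (continuous_pi fun _ => by fun_prop)

/-- Taylor's theorem with the Lagrange remainder along a segment. -/
theorem exists_sub_taylorPoly_eq {u : E → ℝ} {z y : E} {m : ℕ} (hm : 0 < m)
    (hu : ∀ t ∈ Set.Icc (0 : ℝ) 1, ContDiffAt ℝ m u (z + t • (y - z))) :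
    ∃ t ∈ Set.Icc (0 : ℝ) 1, u y - taylorPoly u z m y =
      (iteratedFDeriv ℝ m u (z + t • (y - z)) fun _ => y - z) / m ! := by
  obtain ⟨k, rfl⟩ : ∃ k, m = k + 1 := ⟨m - 1, by omega⟩
  have hI : Set.uIcc (0 : ℝ) 1 = Set.Icc 0 1 := Set.uIcc_of_le zero_le_one
  have hc := contDiffOn_line hu
  obtain ⟨t, ht, h⟩ := taylor_mean_remainder_lagrange (f := fun s : ℝ => u (z + s • (y - z)))
    (n := k) zero_ne_one (by rw [hI]; exact hc.of_le (by exact_mod_cast k.le_succ)) (by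
      rw [hI]
      refine (hc.differentiableOn_iteratedDerivWithin (by exact_mod_cast k.lt_succ_self)
        (uniqueDiffOn_Icc zero_lt_one)).mono ?_
      rw [Set.uIoo_of_le zero_le_one]; exact Set.Ioo_subset_Icc_self)
  rw [Set.uIoo_of_le zero_le_one] at ht
  have ht' := Set.Ioo_subset_Icc_self ht
  refine ⟨t, ht', ?_⟩
  rw [hI, iteratedDerivWithin_line hu le_rfl t ht', taylor_within_apply] at h
  simp only [one_smul, add_sub_cancel, sub_zero, one_pow, mul_one, smul_eq_mul] at h
  rw [← h, taylorPoly]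
  congr 1
  refine Finset.sum_congr rfl fun j hj => ?_
  rw [iteratedDerivWithin_line hu (by have := Finset.mem_range.1 hj; omega) 0 (by simp)]
  simp

/-- Second order Taylor expansion with integral remainder at a critical point. -/
theorem sub_eq_integral_of_critical {u : E → ℝ} (hu : ContDiff ℝ 2 u) {z y : E}
    (hz : fderiv ℝ u z = 0) :
    u y - u z = ∫ t in (0 : ℝ)..1,
      (1 - t) * iteratedFDeriv ℝ 2 u (z + t • (y - z)) fun _ => y - z := by
  have hI : Set.uIcc (0 : ℝ) 1 = Set.Icc 0 1 := Set.uIcc_of_le zero_le_one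
  have hu' : ∀ t ∈ Set.Icc (0 : ℝ) 1, ContDiffAt ℝ (2 : ℕ) u (z + t • (y - z)) :=
    fun t _ => hu.contDiffAt
  have h := taylor_integral_remainder (f := fun s : ℝ => u (z + s • (y - z))) (n := 1)
    (x₀ := 0) (x := 1) (by rw [hI]; exact contDiffOn_line hu')
  have h0 := iteratedDerivWithin_line hu' (j := 1) (by norm_num) 0 (by simp)
  simp only [hI, taylor_within_apply, Finset.sum_range_succ, Finset.sum_range_zero] at h
  rw [h0] at h
  simp only [zero_smul, add_zero, one_smul, add_sub_cancel, iteratedDerivWithin_zero,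
    iteratedFDeriv_one_apply, hz, zero_apply, smul_zero, zero_add] at h
  have h1 : u y - u z = u y - (((0 ! : ℕ) : ℝ)⁻¹ * (1 - 0) ^ 0) • u z := by simp
  rw [h1, h]
  refine intervalIntegral.integral_congr fun t ht => ?_
  rw [hI] at ht
  have := iteratedDerivWithin_line hu' (j := 2) le_rfl t ht
  simp only [smul_eq_mul, Nat.factorial_one, Nat.cast_one, div_one, pow_one]
  rw [← this]

end Segment

end KernelSOS

namespace KernelSOS

/-! ### The sampling inequality -/

theorem multilinear_const_eq_sum {d m : ℕ}
    (T : ContinuousMultilinearMap ℝ (fun _ : Fin m => EuclideanSpace ℝ (Fin d)) ℝ)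
    (v : EuclideanSpace ℝ (Fin d)) :
    T (fun _ => v) = ∑ I : Fin m → Fin d,
      (∏ j, v (I j)) * T fun j => EuclideanSpace.single (I j) (1 : ℝ) := by
  have hv : v = ∑ i, v i • EuclideanSpace.single i (1 : ℝ) := by
    simpa using ((EuclideanSpace.basisFun (Fin d) ℝ).sum_repr v).symm
  conv_lhs => rw [hv]
  rw [ContinuousMultilinearMap.map_sum]
  exact Finset.sum_congr rfl fun I _ => ContinuousMultilinearMap.map_smul_univ _ _ _

theorem sum_abs_le_sqrt_mul_norm {d : ℕ} (v : EuclideanSpace ℝ (Fin d)) :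
    ∑ i, |v i| ≤ √d * ‖v‖ := by
  have := sq_sum_le_card_mul_sum_sq (s := Finset.univ) (f := fun i => |v i|)
  refine le_of_abs_le (abs_le_of_sq_le_sq ?_ (by positivity))
  rw [mul_pow, Real.sq_sqrt (Nat.cast_nonneg d)]
  simpa [EuclideanSpace.norm_sq_eq] using this

theorem abs_iteratedFDeriv_const_le {d m : ℕ} {u : EuclideanSpace ℝ (Fin d) → ℝ}
    {x v : EuclideanSpace ℝ (Fin d)} {C : ℝ} (hC : ∀ I : Fin m → Fin d, |partialDeriv I u x| ≤ C) :
    |iteratedFDeriv ℝ m u x fun _ => v| ≤ (∑ i, |v i|) ^ m * C := by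
  rw [multilinear_const_eq_sum]
  refine (Finset.abs_sum_le_sum_abs _ _).trans ?_
  have h : (∑ i, |v i|) ^ m = ∑ I : Fin m → Fin d, ∏ j, |v (I j)| := by
    rw [← Fin.prod_const, Finset.prod_univ_sum, Fintype.piFinset_univ]
  rw [h, Finset.sum_mul]
  refine Finset.sum_le_sum fun I _ => ?_
  rw [abs_mul, Finset.abs_prod]
  exact mul_le_mul_of_nonneg_left (hC I) (Finset.prod_nonneg fun _ _ => abs_nonneg _)

/-- The remainder of the Taylor polynomial of degree `m - 1`. -/
theorem abs_sub_taylorPoly_le {d m : ℕ} (hm : 0 < m) {u : EuclideanSpace ℝ (Fin d) → ℝ}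
    {Ω : Set (EuclideanSpace ℝ (Fin d))} (hu : ∀ x ∈ Ω, ContDiffAt ℝ m u x) {C : ℝ} (hC0 : 0 ≤ C)
    (hC : ∀ (I : Fin m → Fin d), ∀ x ∈ Ω, |partialDeriv I u x| ≤ C)
    {z y : EuclideanSpace ℝ (Fin d)} {δ : ℝ} (hδ : 0 < δ) (hball : Metric.ball z δ ⊆ Ω)
    (hy : y ∈ Ω) (hyz : y ∈ Metric.closedBall z δ) :
    |u y - taylorPoly u z m y| ≤ (√d * δ) ^ m * C / m ! := by
  have hyz' := mem_closedBall_iff_norm.1 hyz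
  have hseg : ∀ t ∈ Set.Icc (0 : ℝ) 1, z + t • (y - z) ∈ Ω := by
    rintro t ⟨h0, h1⟩
    rcases h1.eq_or_lt with rfl | h1
    · simpa using hy
    · refine hball ?_
      rw [mem_ball_iff_norm, add_sub_cancel_left, norm_smul, Real.norm_of_nonneg h0]
      nlinarith
  obtain ⟨t, ht, h⟩ := exists_sub_taylorPoly_eq hm fun t ht => hu _ (hseg t ht)
  rw [h, abs_div, Nat.abs_cast]
  gcongr
  refine (abs_iteratedFDeriv_const_le fun I => hC I _ (hseg t ht)).trans ?_
  gcongr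
  exact (sum_abs_le_sqrt_mul_norm _).trans (by gcongr)

/-- The constant of the sampling inequality, in terms of the ratio `max 1 (18 (m - 1)²)` between
the radius of the balls used and the fill distance. -/
theorem constC_eq (d : ℕ) {m : ℕ} (hm : 0 < m) :
    constC d m = 3 * (d * max 1 (18 * ((m : ℝ) - 1) ^ 2)) ^ m / m ! := by
  have hm1 : (0 : ℝ) ≤ (m : ℝ) - 1 := sub_nonneg.2 (by exact_mod_cast hm)
  rw [constC, pow_mul]
  congr 3
  have h0 : (0 : ℝ) ≤ 3 * √(2 * (d : ℝ)) * ((m : ℝ) - 1) := by positivity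
  have e1 : (3 * √(2 * (d : ℝ)) * ((m : ℝ) - 1)) ^ 2 = d * (18 * ((m : ℝ) - 1) ^ 2) := by
    rw [mul_pow, mul_pow, Real.sq_sqrt (by positivity)]; ring
  have e2 : (√(d : ℝ)) ^ 2 = d * 1 := by rw [Real.sq_sqrt (by positivity), mul_one]
  rw [mul_max_of_nonneg _ _ (Nat.cast_nonneg d), ← e1, ← e2]
  rcases le_total (√(d : ℝ)) (3 * √(2 * (d : ℝ)) * ((m : ℝ) - 1)) with h | h
  · rw [max_eq_right h, max_eq_right (by gcongr)]
  · rw [max_eq_left h, max_eq_left (by gcongr)]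

theorem exists_ball_subset_of_mem_ball {E : Type*} [NormedAddCommGroup E] [NormedSpace ℝ E]
    {x₀ x : E} {r δ : ℝ} (hδ : 0 < δ) (hδr : δ ≤ r) (hx : x ∈ Metric.ball x₀ r) :
    ∃ z, Metric.ball z δ ⊆ Metric.ball x₀ r ∧ x ∈ Metric.ball z δ := by
  have hr : 0 < r := hδ.trans_le hδr
  have hx' := mem_ball_iff_norm.1 hx
  refine ⟨x - (δ / r) • (x - x₀), Metric.ball_subset_ball' ?_, ?_⟩
  · have e : x - (δ / r) • (x - x₀) - x₀ = (1 - δ / r) • (x - x₀) := by module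
    have h1 : 0 ≤ 1 - δ / r := sub_nonneg.2 ((div_le_one hr).2 hδr)
    rw [dist_eq_norm, e, norm_smul, Real.norm_of_nonneg h1]
    have : (1 - δ / r) * ‖x - x₀‖ ≤ (1 - δ / r) * r := mul_le_mul_of_nonneg_left hx'.le h1
    have e2 : (1 - δ / r) * r = r - δ := by field_simp
    linarith
  · rw [mem_ball_iff_norm, sub_sub_cancel, norm_smul, Real.norm_of_nonneg (by positivity),
      div_mul_eq_mul_div, div_lt_iff₀ hr]
    gcongr

/-- **Sampling inequality.** A function of class `C^m` on a union of balls which vanishes at data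
sites of fill distance at most `h` is bounded by `C₀ h^m` times its derivatives of order `m`. -/
theorem abs_le_of_vanishing {d m : ℕ} (hd : 0 < d) (hm : 0 < m)
    {Ω : Set (EuclideanSpace ℝ (Fin d))} {r : ℝ} (hΩ : IsUnionOfBalls Ω r)
    {u : EuclideanSpace ℝ (Fin d) → ℝ}
    (hu : ∀ x ∈ Ω, ContDiffAt ℝ m u x) {C : ℝ} (hC0 : 0 ≤ C)
    (hC : ∀ (I : Fin m → Fin d), ∀ x ∈ Ω, |partialDeriv I u x| ≤ C)
    {Y : Set (EuclideanSpace ℝ (Fin d))} (hYΩ : Y ⊆ Ω) (hY0 : ∀ y ∈ Y, u y = 0) {h : ℝ}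
    (hh : 0 ≤ h) (hhr : h ≤ r / max 1 (18 * ((m : ℝ) - 1) ^ 2))
    (hY : ∀ w ∈ Ω, ∃ y ∈ Y, ‖w - y‖ ≤ h) {x : EuclideanSpace ℝ (Fin d)} (hx : x ∈ Ω) :
    |u x| ≤ constC d m * h ^ m * C := by
  set L : ℝ := max 1 (18 * ((m : ℝ) - 1) ^ 2) with hL
  have hL1 : 1 ≤ L := le_max_left _ _
  have hcon : constC d m = 3 * (d * L) ^ m / m ! := constC_eq d hm
  have hrhs : 0 ≤ constC d m * h ^ m * C := by rw [hcon]; positivity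
  rcases hh.eq_or_lt with rfl | hh
  · obtain ⟨y, hy, hxy⟩ := hY x hx
    have : x = y := sub_eq_zero.1 (norm_le_zero_iff.1 hxy)
    rw [this, hY0 y hy, abs_zero]
    exact hrhs
  obtain ⟨-, S, -, rfl⟩ := hΩ
  obtain ⟨x₀, hx₀, hxx⟩ := Set.mem_iUnion₂.1 hx
  have hδ : 0 < L * h := by positivity
  have hδr : L * h ≤ r := by rw [mul_comm]; exact (le_div_iff₀ (by positivity)).1 hhr
  obtain ⟨z, hz, hxz⟩ := exists_ball_subset_of_mem_ball hδ hδr hxx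
  have hball : Metric.ball z (L * h) ⊆ ⋃ x ∈ S, Metric.ball x r :=
    hz.trans (Set.subset_biUnion_of_mem (u := fun x => Metric.ball x r) hx₀)
  -- Expanding at the centre of the ball, `u` differs from its Taylor polynomial by at most `e`, and
  -- the polynomial is at most `e` at the data sites, hence at most `2 e` on the ball.
  set e : ℝ := (√d * (L * h)) ^ m * C / m ! with he
  have hP : |taylorPoly u z m x| ≤ 2 * e := by
    refine (isPolyOnLines_taylorPoly u z m).abs_le_of_dense (continuous_taylorPoly u z m) hL1 ?_ hh
      (Y := Y) (fun w hw => hY w (hball hw)) ?_ (Metric.ball_subset_closedBall hxz)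
    · rw [Nat.cast_sub hm, Nat.cast_one]; exact le_max_right _ _
    · intro y hy hyz
      have := abs_sub_taylorPoly_le hm hu hC0 hC hδ hball (hYΩ hy) hyz
      rwa [hY0 y hy, zero_sub, abs_neg] at this
  have hR := abs_sub_taylorPoly_le hm hu hC0 hC hδ hball hx (Metric.ball_subset_closedBall hxz)
  have h3 : |u x| ≤ 3 * e := by
    have := abs_sub_abs_le_abs_sub (u x) (taylorPoly u z m x)
    linarith
  refine h3.trans ?_
  have hsq : √(d : ℝ) ≤ d := Real.sqrt_le_left (by positivity) |>.2 (by
    have : (1 : ℝ) ≤ d := by exact_mod_cast hd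
    nlinarith)
  calc 3 * e ≤ 3 * ((d * (L * h)) ^ m * C / m !) := by rw [he]; gcongr
    _ = constC d m * h ^ m * C := by rw [hcon, ← mul_assoc (d : ℝ), mul_pow _ h]; ring

end KernelSOS

namespace KernelSOS

open Filter Topology

/-! ### Differentiability of feature maps from diagonal derivatives of the kernel -/

section DiagonalDerivative

variable {E F : Type*} [NormedAddCommGroup E] [NormedSpace ℝ E]

theorem hasDerivAt_of_hasLineDerivAt [NormedAddCommGroup F] [NormedSpace ℝ F] {f : E → F} {f' : F}
    {y e : E} {t τ : ℝ} (h : HasLineDerivAt ℝ f f' (y + (τ * t) • e) e) :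
    HasDerivAt (fun τ' : ℝ => f (y + (τ' * t) • e)) (t • f') τ := by
  have h1 : HasDerivAt (fun τ' : ℝ => (τ' - τ) * t) t τ := by
    simpa using ((hasDerivAt_id τ).sub_const τ).mul_const t
  have h2 : HasDerivAt (fun r : ℝ => f (y + (τ * t) • e + r • e)) f' ((τ - τ) * t) := by
    rw [sub_self, zero_mul]; exact h
  have h3 := HasDerivAt.scomp τ h2 h1
  convert h3 using 2 with τ'
  simp only [Function.comp_apply]
  rw [add_assoc, ← add_smul]
  ring_nf

/-- The second mixed difference of a kernel is a value of its mixed derivative. -/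
theorem exists_mixed_difference_eq {Ω : Set E} {e : E} {K : E → E → ℝ}
    (hr : ∀ x ∈ Ω, ∀ y ∈ Ω, LineDifferentiableAt ℝ (fun y' => K x y') y e)
    (hl : ∀ x ∈ Ω, ∀ y ∈ Ω,
      LineDifferentiableAt ℝ (fun x' => lineDeriv ℝ (fun y' => K x' y') y e) x e)
    {x y : E} {s t : ℝ} (hx : ∀ a ∈ Set.Icc (0 : ℝ) 1, x + (a * s) • e ∈ Ω)
    (hy : ∀ a ∈ Set.Icc (0 : ℝ) 1, y + (a * t) • e ∈ Ω) :
    ∃ a ∈ Set.Icc (0 : ℝ) 1, ∃ b ∈ Set.Icc (0 : ℝ) 1,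
      K (x + s • e) (y + t • e) - K x (y + t • e) - (K (x + s • e) y - K x y) =
        t * (s * lineDeriv ℝ (fun x' => lineDeriv ℝ (fun y' => K x' y') (y + (b * t) • e) e)
          (x + (a * s) • e) e) := by
  have hx0 : x ∈ Ω := by simpa using hx 0 (by simp)
  have hx1 : x + s • e ∈ Ω := by simpa using hx 1 (by simp)
  have hd1 : ∀ b ∈ Set.Icc (0 : ℝ) 1, HasDerivAt
      (fun b : ℝ => K (x + s • e) (y + (b * t) • e) - K x (y + (b * t) • e))
      (t • lineDeriv ℝ (fun y' => K (x + s • e) y') (y + (b * t) • e) e -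
        t • lineDeriv ℝ (fun y' => K x y') (y + (b * t) • e) e) b := fun b hb =>
    (hasDerivAt_of_hasLineDerivAt (hr _ hx1 _ (hy b hb)).hasLineDerivAt).sub
      (hasDerivAt_of_hasLineDerivAt (hr _ hx0 _ (hy b hb)).hasLineDerivAt)
  obtain ⟨b, hb, hbe⟩ := exists_hasDerivAt_eq_slope _ _ zero_lt_one
    (fun b hb => (hd1 b hb).continuousAt.continuousWithinAt)
    fun b hb => hd1 b (Set.Ioo_subset_Icc_self hb)
  have hb' := Set.Ioo_subset_Icc_self hb
  have hd2 : ∀ a ∈ Set.Icc (0 : ℝ) 1, HasDerivAt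
      (fun a : ℝ => lineDeriv ℝ (fun y' => K (x + (a * s) • e) y') (y + (b * t) • e) e)
      (s • lineDeriv ℝ (fun x' => lineDeriv ℝ (fun y' => K x' y') (y + (b * t) • e) e)
          (x + (a * s) • e) e) a := fun a ha =>
    hasDerivAt_of_hasLineDerivAt (hl _ (hx a ha) _ (hy b hb')).hasLineDerivAt
  obtain ⟨a, ha, hae⟩ := exists_hasDerivAt_eq_slope _ _ zero_lt_one
    (fun a ha => (hd2 a ha).continuousAt.continuousWithinAt)
    fun a ha => hd2 a (Set.Ioo_subset_Icc_self ha)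
  refine ⟨a, Set.Ioo_subset_Icc_self ha, b, hb', ?_⟩
  simp only [smul_eq_mul, sub_zero, div_one, one_mul, zero_mul, zero_smul, add_zero] at hae hbe
  rw [hae, mul_sub, hbe]

variable [NormedAddCommGroup F] [InnerProductSpace ℝ F]

/-- The inner products of difference quotients of a feature map converge to the mixed derivative of
its kernel. -/
theorem tendsto_inner_slope_slope {Ω : Set E} (hΩ : IsOpen Ω) {e : E} {K : E → E → ℝ}
    (hr : ∀ x ∈ Ω, ∀ y ∈ Ω, LineDifferentiableAt ℝ (fun y' => K x y') y e)
    (hl : ∀ x ∈ Ω, ∀ y ∈ Ω,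
      LineDifferentiableAt ℝ (fun x' => lineDeriv ℝ (fun y' => K x' y') y e) x e)
    (hc : ContinuousOn (fun p : E × E =>
      lineDeriv ℝ (fun x' => lineDeriv ℝ (fun y' => K x' y') p.2 e) p.1 e) (Ω ×ˢ Ω))
    {ψ : E → F} (hK : ∀ x ∈ Ω, ∀ y ∈ Ω, K x y = ⟪ψ x, ψ y⟫) {x y : E} (hx : x ∈ Ω) (hy : y ∈ Ω) :
    Tendsto (fun p : ℝ × ℝ => ⟪p.1⁻¹ • (ψ (x + p.1 • e) - ψ x), p.2⁻¹ • (ψ (y + p.2 • e) - ψ y)⟫)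
      (𝓝[≠] 0 ×ˢ 𝓝[≠] 0)
      (𝓝 (lineDeriv ℝ (fun x' => lineDeriv ℝ (fun y' => K x' y') y e) x e)) := by
  set K2 : E × E → ℝ := fun p =>
    lineDeriv ℝ (fun x' => lineDeriv ℝ (fun y' => K x' y') p.2 e) p.1 e with hK2
  have hc' : ContinuousAt K2 (x, y) :=
    hc.continuousAt ((hΩ.prod hΩ).mem_nhds ⟨hx, hy⟩)
  change Tendsto _ _ (𝓝 (K2 (x, y)))
  rw [Metric.tendsto_nhds]
  intro ε hε
  obtain ⟨δ₁, hδ₁, h1⟩ := Metric.continuousAt_iff.1 hc' ε hε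
  obtain ⟨δ₂, hδ₂, h2⟩ := Metric.isOpen_iff.1 hΩ x hx
  obtain ⟨δ₃, hδ₃, h3⟩ := Metric.isOpen_iff.1 hΩ y hy
  set δ := min δ₁ (min δ₂ δ₃) with hδ
  have hδ0 : 0 < δ := by positivity
  have hsmall : ∀ᶠ s : ℝ in 𝓝[≠] 0, s ≠ 0 ∧ ‖s • e‖ < δ := by
    refine (eventually_mem_nhdsWithin (a := (0 : ℝ)) (s := {0}ᶜ)).and ?_
    have : Tendsto (fun s : ℝ => ‖s • e‖) (𝓝 0) (𝓝 0) := by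
      have : Continuous fun s : ℝ => ‖s • e‖ := by fun_prop
      simpa using this.tendsto 0
    exact (this.mono_left nhdsWithin_le_nhds).eventually_lt_const hδ0
  filter_upwards [hsmall.prod_mk hsmall] with p hp
  obtain ⟨⟨hs0, hs⟩, ht0, ht⟩ := hp
  have hle : ∀ (a s : ℝ), a ∈ Set.Icc (0 : ℝ) 1 → ‖s • e‖ < δ → ‖(a * s) • e‖ < δ := by
    intro a s ha hs
    rw [mul_smul, norm_smul, Real.norm_of_nonneg ha.1]
    nlinarith [norm_nonneg (s • e), ha.2]
  have hmx : ∀ a ∈ Set.Icc (0 : ℝ) 1, x + (a * p.1) • e ∈ Ω := fun a ha => h2 <| by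
    rw [mem_ball_iff_norm, add_sub_cancel_left]
    exact (hle a _ ha hs).trans_le ((min_le_right _ _).trans (min_le_left _ _))
  have hmy : ∀ a ∈ Set.Icc (0 : ℝ) 1, y + (a * p.2) • e ∈ Ω := fun a ha => h3 <| by
    rw [mem_ball_iff_norm, add_sub_cancel_left]
    exact (hle a _ ha ht).trans_le ((min_le_right _ _).trans (min_le_right _ _))
  obtain ⟨a, ha, b, hb, hab⟩ := exists_mixed_difference_eq hr hl hmx hmy
  have hx1 : x + p.1 • e ∈ Ω := by simpa using hmx 1 (by simp)
  have hy1 : y + p.2 • e ∈ Ω := by simpa using hmy 1 (by simp)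
  have heq : ⟪p.1⁻¹ • (ψ (x + p.1 • e) - ψ x), p.2⁻¹ • (ψ (y + p.2 • e) - ψ y)⟫ =
      K2 (x + (a * p.1) • e, y + (b * p.2) • e) := by
    rw [hK _ hx1 _ hy1, hK _ hx _ hy1, hK _ hx1 _ hy, hK _ hx _ hy] at hab
    rw [inner_smul_left, inner_smul_right, inner_sub_left, inner_sub_right, inner_sub_right,
      RCLike.conj_to_real]
    have : K2 (x + (a * p.1) • e, y + (b * p.2) • e) = p.1⁻¹ * (p.2⁻¹ * (p.2 * (p.1 *
      K2 (x + (a * p.1) • e, y + (b * p.2) • e)))) := by field_simp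
    rw [this, ← hab]
    ring
  rw [heq]
  refine h1 ?_
  rw [Prod.dist_eq, max_lt_iff, dist_eq_norm, dist_eq_norm, add_sub_cancel_left, add_sub_cancel_left]
  exact ⟨(hle a _ ha hs).trans_le (min_le_left _ _), (hle b _ hb ht).trans_le (min_le_left _ _)⟩

/-- If a kernel `⟪ψ x, ψ y⟫` has a continuous mixed derivative in one direction, then the feature
map `ψ` is differentiable in this direction: the inner products of its difference quotients
converge, so the quotients are Cauchy. -/
theorem lineDifferentiableAt_of_inner [CompleteSpace F] {Ω : Set E} (hΩ : IsOpen Ω) {e : E}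
    {K : E → E → ℝ}
    (hr : ∀ x ∈ Ω, ∀ y ∈ Ω, LineDifferentiableAt ℝ (fun y' => K x y') y e)
    (hl : ∀ x ∈ Ω, ∀ y ∈ Ω,
      LineDifferentiableAt ℝ (fun x' => lineDeriv ℝ (fun y' => K x' y') y e) x e)
    (hc : ContinuousOn (fun p : E × E =>
      lineDeriv ℝ (fun x' => lineDeriv ℝ (fun y' => K x' y') p.2 e) p.1 e) (Ω ×ˢ Ω))
    {ψ : E → F} (hK : ∀ x ∈ Ω, ∀ y ∈ Ω, K x y = ⟪ψ x, ψ y⟫) :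
    (∀ x ∈ Ω, LineDifferentiableAt ℝ ψ x e) ∧
    ∀ x ∈ Ω, ∀ y ∈ Ω, lineDeriv ℝ (fun x' => lineDeriv ℝ (fun y' => K x' y') y e) x e =
      ⟪lineDeriv ℝ ψ x e, lineDeriv ℝ ψ y e⟫ := by
  have hdiff : ∀ x ∈ Ω, LineDifferentiableAt ℝ ψ x e := by
    intro x hx
    set g : ℝ → F := fun s => s⁻¹ • (ψ (x + s • e) - ψ x) with hg
    set c := lineDeriv ℝ (fun x' => lineDeriv ℝ (fun y' => K x' y') x e) x e
    have hT : Tendsto (fun p : ℝ × ℝ => ⟪g p.1, g p.2⟫) (𝓝[≠] 0 ×ˢ 𝓝[≠] 0) (𝓝 c) :=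
      tendsto_inner_slope_slope hΩ hr hl hc hK hx hx
    have hD : Tendsto (fun s : ℝ => ⟪g s, g s⟫) (𝓝[≠] 0) (𝓝 c) :=
      hT.comp (tendsto_id.prodMk tendsto_id)
    have hdist : Tendsto (fun p : ℝ × ℝ => dist (g p.1) (g p.2)) (𝓝[≠] 0 ×ˢ 𝓝[≠] 0) (𝓝 0) := by
      have h1 : Tendsto (fun p : ℝ × ℝ => ⟪g p.1, g p.1⟫ - 2 * ⟪g p.1, g p.2⟫ + ⟪g p.2, g p.2⟫)
          (𝓝[≠] 0 ×ˢ 𝓝[≠] 0) (𝓝 (c - 2 * c + c)) :=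
        ((hD.comp tendsto_fst).sub (hT.const_mul 2)).add (hD.comp tendsto_snd)
      rw [show c - 2 * c + c = 0 by ring] at h1
      have h2 := h1.sqrt
      rw [Real.sqrt_zero] at h2
      refine h2.congr fun p => ?_
      rw [dist_eq_norm, real_inner_self_eq_norm_sq, real_inner_self_eq_norm_sq,
        ← norm_sub_sq_real, Real.sqrt_sq (norm_nonneg _)]
    have hcau : Cauchy (map g (𝓝[≠] 0)) := by
      refine cauchy_map_iff.2 ⟨inferInstance, ?_⟩
      exact tendsto_uniformity_iff_dist_tendsto_zero.2 hdist
    obtain ⟨v, hv⟩ := CompleteSpace.complete hcau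
    refine HasLineDerivAt.lineDifferentiableAt (f' := v) ?_
    rw [HasLineDerivAt, hasDerivAt_iff_tendsto_slope_zero]
    simpa [hg] using! (show Tendsto g (𝓝[≠] 0) (𝓝 v) from hv)
  refine ⟨hdiff, fun x hx y hy => ?_⟩
  have hlim : ∀ x ∈ Ω, Tendsto (fun s : ℝ => s⁻¹ • (ψ (x + s • e) - ψ x)) (𝓝[≠] 0)
      (𝓝 (lineDeriv ℝ ψ x e)) := by
    intro x hx
    have := hasDerivAt_iff_tendsto_slope_zero.1 (hdiff x hx).hasLineDerivAt
    simpa using this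
  refine tendsto_nhds_unique (tendsto_inner_slope_slope hΩ hr hl hc hK hx hy) ?_
  exact ((hlim x hx).comp tendsto_fst).inner ((hlim y hy).comp tendsto_snd)

theorem continuousOn_of_inner {X : Type*} [TopologicalSpace X] {Ω : Set X} {K : X → X → ℝ}
    (hc : ContinuousOn (fun p : X × X => K p.1 p.2) (Ω ×ˢ Ω)) {ψ : X → F}
    (hK : ∀ x ∈ Ω, ∀ y ∈ Ω, K x y = ⟪ψ x, ψ y⟫) : ContinuousOn ψ Ω := by
  intro x hx
  rw [ContinuousWithinAt, tendsto_iff_dist_tendsto_zero]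
  have hx2 : ContinuousWithinAt (fun y => K y y) Ω x :=
    (hc (x, x) ⟨hx, hx⟩).comp (f := fun y => (y, y)) (by fun_prop) fun y hy => ⟨hy, hy⟩
  have hx1 : ContinuousWithinAt (fun y => K y x) Ω x :=
    (hc (x, x) ⟨hx, hx⟩).comp (f := fun y => (y, x)) (by fun_prop) fun y hy => ⟨hy, hx⟩
  have h1 : Tendsto (fun y => √(K y y - 2 * K y x + K x x)) (𝓝[Ω] x) (𝓝 0) := by
    have := (((hx2.tendsto).sub ((hx1.tendsto).const_mul 2)).add_const (K x x)).sqrt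
    rwa [show K x x - 2 * K x x + K x x = 0 by ring, Real.sqrt_zero] at this
  refine h1.congr' ?_
  filter_upwards [self_mem_nhdsWithin] with y hy
  rw [dist_eq_norm, hK y hy y hy, hK y hy x hx, hK x hx x hx, real_inner_self_eq_norm_sq,
    real_inner_self_eq_norm_sq, ← norm_sub_sq_real, Real.sqrt_sq (norm_nonneg _)]

end DiagonalDerivative

/-! ### Continuous partial derivatives -/

section Partials

variable {d : ℕ} {F : Type*} [NormedAddCommGroup F] [NormedSpace ℝ F]

/-- Continuous partial derivatives on an open set give the Fréchet derivative. -/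
theorem hasFDerivAt_of_continuous_partials {Ω : Set (EuclideanSpace ℝ (Fin d))} (hΩ : IsOpen Ω)
    {g : EuclideanSpace ℝ (Fin d) → F} {G : Fin d → EuclideanSpace ℝ (Fin d) → F}
    (hG : ∀ i, ∀ x ∈ Ω, HasLineDerivAt ℝ g (G i x) x (EuclideanSpace.single i 1))
    (hGc : ∀ i, ContinuousOn (G i) Ω) {x : EuclideanSpace ℝ (Fin d)} (hx : x ∈ Ω) :
    HasFDerivAt g (∑ i, (EuclideanSpace.proj i : EuclideanSpace ℝ (Fin d) →L[ℝ] ℝ).smulRight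
      (G i x)) x := by
  rw [hasFDerivAt_iff_isLittleO_nhds_zero, Asymptotics.isLittleO_iff]
  intro c hc
  obtain ⟨ε, hε, hεc⟩ : ∃ ε : ℝ, 0 < ε ∧ ε * √d ≤ c :=
    ⟨c / (√d + 1), by positivity, by
      rw [div_mul_eq_mul_div, div_le_iff₀ (by positivity)]; nlinarith [Real.sqrt_nonneg (d : ℝ)]⟩
  have hnear : ∀ᶠ y in 𝓝 x, y ∈ Ω ∧ ∀ i, ‖G i y - G i x‖ ≤ ε := by
    refine (hΩ.eventually_mem hx).and (eventually_all.2 fun i => ?_)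
    have := ((hGc i).continuousAt (hΩ.mem_nhds hx)).sub_const (G i x)
    have := this.norm
    simp only [sub_self, norm_zero] at this
    exact (this.eventually_lt_const hε).mono fun y hy => le_of_lt hy
  obtain ⟨δ, hδ, hball⟩ := Metric.eventually_nhds_iff_ball.1 hnear
  have hev : ∀ᶠ v : EuclideanSpace ℝ (Fin d) in 𝓝 0, √d * ‖v‖ < δ := by
    have : Continuous fun v : EuclideanSpace ℝ (Fin d) => √d * ‖v‖ := by fun_prop
    have := this.tendsto 0
    rw [norm_zero, mul_zero] at this
    exact this.eventually_lt_const hδ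
  filter_upwards [hev] with v hv
  -- The coordinates of `v` are switched on one after the other.
  set w : Finset (Fin d) → EuclideanSpace ℝ (Fin d) := fun s =>
    ∑ i ∈ s, v i • EuclideanSpace.single i (1 : ℝ) with hw
  have key : ∀ s : Finset (Fin d),
      ‖g (x + w s) - g x - ∑ i ∈ s, v i • G i x‖ ≤ ε * ∑ i ∈ s, |v i| := by
    intro s
    induction s using Finset.induction_on with
    | empty => simp [hw]
    | insert a s ha ih =>
      have hwa : w (insert a s) = w s + v a • EuclideanSpace.single a (1 : ℝ) := by
        simp only [hw]; rw [Finset.sum_insert ha, add_comm]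
      have hin : ∀ t ∈ Set.Icc (0 : ℝ) 1,
          x + w s + (t * v a) • EuclideanSpace.single a (1 : ℝ) ∈ Metric.ball x δ := by
        intro t ht
        rw [mem_ball_iff_norm, add_assoc, add_sub_cancel_left]
        refine lt_of_le_of_lt ?_ hv
        refine le_trans ?_ (sum_abs_le_sqrt_mul_norm v)
        refine (norm_add_le _ _).trans ?_
        have e1 : ‖w s‖ ≤ ∑ i ∈ s, |v i| := by
          refine (norm_sum_le _ _).trans (Finset.sum_le_sum fun i _ => ?_)
          simp [norm_smul]
        have e2 : ‖(t * v a) • EuclideanSpace.single a (1 : ℝ)‖ ≤ |v a| := by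
          rw [norm_smul, PiLp.norm_single, norm_one, mul_one, norm_mul,
            Real.norm_of_nonneg ht.1, Real.norm_eq_abs]
          nlinarith [abs_nonneg (v a), ht.2]
        calc _ ≤ ∑ i ∈ s, |v i| + |v a| := add_le_add e1 e2
          _ = ∑ i ∈ insert a s, |v i| := by rw [Finset.sum_insert ha, add_comm]
          _ ≤ _ := Finset.sum_le_univ_sum_of_nonneg fun i => abs_nonneg _
      have hd : ∀ t ∈ Set.Icc (0 : ℝ) 1, HasDerivWithinAt
          (fun t : ℝ => g (x + w s + (t * v a) • EuclideanSpace.single a (1 : ℝ)) -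
            t • (v a • G a x))
          (v a • G a (x + w s + (t * v a) • EuclideanSpace.single a (1 : ℝ)) -
            (1 : ℝ) • (v a • G a x)) (Set.Icc 0 1) t := fun t ht =>
        ((hasDerivAt_of_hasLineDerivAt (hG a _ (hball _ (hin t ht)).1)).sub
          ((hasDerivAt_id t).smul_const _)).hasDerivWithinAt
      have hmv := norm_image_sub_le_of_norm_deriv_le_segment_01' (C := ε * |v a|) hd fun t ht => by
        rw [one_smul, ← smul_sub, norm_smul, Real.norm_eq_abs, mul_comm]
        exact mul_le_mul_of_nonneg_right ((hball _ (hin t (Set.Ico_subset_Icc_self ht))).2 a)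
          (abs_nonneg _)
      simp only [one_mul, zero_mul, zero_smul, one_smul, add_zero, sub_zero] at hmv
      rw [Finset.sum_insert ha, Finset.sum_insert ha, hwa, mul_add, ← add_assoc]
      have e : g (x + w s + v a • EuclideanSpace.single a (1 : ℝ)) - g x -
          (v a • G a x + ∑ i ∈ s, v i • G i x) =
          (g (x + w s + v a • EuclideanSpace.single a (1 : ℝ)) - v a • G a x - g (x + w s)) +
          (g (x + w s) - g x - ∑ i ∈ s, v i • G i x) := by abel
      rw [e]
      exact (norm_add_le _ _).trans (add_le_add hmv ih)
  have hwv : w Finset.univ = v := by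
    simpa [hw] using (EuclideanSpace.basisFun (Fin d) ℝ).sum_repr v
  have hfin := key Finset.univ
  rw [hwv] at hfin
  have e : (∑ i, (EuclideanSpace.proj i : EuclideanSpace ℝ (Fin d) →L[ℝ] ℝ).smulRight
      (G i x)) v = ∑ i, v i • G i x := by
    simp
  rw [e]
  refine hfin.trans ?_
  calc _ ≤ ε * (√d * ‖v‖) := by gcongr; exact sum_abs_le_sqrt_mul_norm v
    _ = ε * √d * ‖v‖ := by ring
    _ ≤ c * ‖v‖ := by gcongr

/-- Iterated partial derivatives; the head of the list is the direction differentiated last. -/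
noncomputable def iterPartial (g : EuclideanSpace ℝ (Fin d) → F) :
    List (Fin d) → EuclideanSpace ℝ (Fin d) → F
  | [] => g
  | i :: l => fun x => lineDeriv ℝ (iterPartial g l) x (EuclideanSpace.single i 1)

theorem iterPartial_append (g : EuclideanSpace ℝ (Fin d) → F) (i : Fin d) (l : List (Fin d)) :
    iterPartial g (l ++ [i]) = iterPartial (iterPartial g [i]) l := by
  induction l with
  | nil => rfl
  | cons j l ih => simp only [List.cons_append, iterPartial, ih]

theorem contDiffOn_of_iterPartial {Ω : Set (EuclideanSpace ℝ (Fin d))} (hΩ : IsOpen Ω) {n : ℕ}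
    {g : EuclideanSpace ℝ (Fin d) → F}
    (hdiff : ∀ (l : List (Fin d)) (i : Fin d), l.length < n → ∀ x ∈ Ω,
      LineDifferentiableAt ℝ (iterPartial g l) x (EuclideanSpace.single i 1))
    (hcont : ∀ l : List (Fin d), l.length ≤ n → ContinuousOn (iterPartial g l) Ω) :
    ContDiffOn ℝ n g Ω := by
  induction n generalizing g with
  | zero => exact contDiffOn_zero.2 (hcont [] le_rfl)
  | succ n ih =>
    have hF : ∀ x ∈ Ω, HasFDerivAt g (∑ i,
        (EuclideanSpace.proj i : EuclideanSpace ℝ (Fin d) →L[ℝ] ℝ).smulRight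
          (iterPartial g [i] x)) x := fun x hx =>
      hasFDerivAt_of_continuous_partials hΩ
        (fun i x hx => (hdiff [] i (by simp) x hx).hasLineDerivAt)
        (fun i => hcont [i] (by simp)) hx
    have hn : ((n + 1 : ℕ) : WithTop ℕ∞) = (n : WithTop ℕ∞) + 1 := by push_cast; rfl
    rw [hn, contDiffOn_succ_iff_fderiv_of_isOpen hΩ]
    refine ⟨fun x hx => (hF x hx).differentiableAt.differentiableWithinAt, by simp, ?_⟩
    refine ContDiffOn.congr ?_ fun x hx => (hF x hx).fderiv
    refine ContDiffOn.sum fun i _ => contDiffOn_const.smulRight ?_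
    refine ih (fun l j hl x hx => ?_) fun l hl => ?_
    · rw [← iterPartial_append]
      exact hdiff _ j (by simpa using hl) x hx
    · rw [← iterPartial_append]
      exact hcont _ (by simpa using hl)

theorem iteratedFDeriv_single_eq_iterPartial {Ω : Set (EuclideanSpace ℝ (Fin d))} (hΩ : IsOpen Ω)
    {m : ℕ} {g : EuclideanSpace ℝ (Fin d) → F} (hg : ContDiffOn ℝ m g Ω) {n : ℕ} (hn : n ≤ m)
    (I : Fin n → Fin d) {x : EuclideanSpace ℝ (Fin d)} (hx : x ∈ Ω) :
    iteratedFDeriv ℝ n g x (fun j => EuclideanSpace.single (I j) (1 : ℝ)) =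
      iterPartial g (List.ofFn I) x := by
  induction n generalizing x with
  | zero => simp [iterPartial]
  | succ n ih =>
    rw [List.ofFn_succ, iterPartial, iteratedFDeriv_succ_apply_left]
    have h1 : DifferentiableAt ℝ (iteratedFDeriv ℝ n g) x :=
      (hg.contDiffAt (hΩ.mem_nhds hx)).differentiableAt_iteratedFDeriv (by exact_mod_cast hn)
    have h2 := (ContinuousMultilinearMap.apply ℝ (fun _ : Fin n => EuclideanSpace ℝ (Fin d)) F
      (fun j => EuclideanSpace.single (I j.succ) 1)).hasFDerivAt.comp x h1.hasFDerivAt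
    have h3 := h2.hasLineDerivAt (EuclideanSpace.single (I 0) 1)
    have h4 : (fun y => iteratedFDeriv ℝ n g y fun j => EuclideanSpace.single (I j.succ) (1 : ℝ))
        =ᶠ[𝓝 x] iterPartial g (List.ofFn fun j => I j.succ) := by
      filter_upwards [hΩ.mem_nhds hx] with y hy
      exact ih (by omega) _ hy
    beta_reduce
    rw [← h4.lineDeriv_eq]
    exact h3.lineDeriv.symm

end Partials

end KernelSOS

namespace KernelSOS

/-! ### Regularity of the functions of the reproducing kernel Hilbert space -/

theorem IsUnionOfBalls.isOpen {d : ℕ} {Ω : Set (EuclideanSpace ℝ (Fin d))} {r : ℝ}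
    (h : IsUnionOfBalls Ω r) : IsOpen Ω := by
  obtain ⟨-, S, -, rfl⟩ := h
  exact isOpen_biUnion fun _ _ => Metric.isOpen_ball

theorem IsUnionOfBalls.isBounded {d : ℕ} {Ω : Set (EuclideanSpace ℝ (Fin d))} {r : ℝ}
    (h : IsUnionOfBalls Ω r) : Bornology.IsBounded Ω := by
  obtain ⟨-, S, hS, rfl⟩ := h
  exact hS.thickening.subset (Metric.thickening_eq_biUnion_ball (δ := r)).ge

section Regularity

variable {d : ℕ} {Ω : Set (EuclideanSpace ℝ (Fin d))}
  {H : Type*} [NormedAddCommGroup H] [InnerProductSpace ℝ H] [CompleteSpace H] [RKHS ℝ H Ω ℝ]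

theorem zeroExt_coe (u : Ω → ℝ) (x : Ω) : zeroExt u (x : EuclideanSpace ℝ (Fin d)) = u x :=
  Subtype.val_injective.extend_apply u 0 x

theorem zeroExt_of_mem (u : Ω → ℝ) {x : EuclideanSpace ℝ (Fin d)} (hx : x ∈ Ω) :
    zeroExt u x = u ⟨x, hx⟩ :=
  zeroExt_coe u ⟨x, hx⟩

variable (H) in
/-- The feature map extended by zero to the whole space. -/
noncomputable def featureExt (x : EuclideanSpace ℝ (Fin d)) : H :=
  Function.extend Subtype.val (feature H : Ω → H) 0 x

theorem featureExt_coe (x : Ω) : featureExt H (x : EuclideanSpace ℝ (Fin d)) = feature H x :=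
  Subtype.val_injective.extend_apply _ _ _

theorem featureExt_of_notMem {x : EuclideanSpace ℝ (Fin d)} (hx : x ∉ Ω) : featureExt H x = 0 :=
  Function.extend_apply' _ _ _ (by simpa using hx)

theorem zeroExt_eq_inner (u : H) (x : EuclideanSpace ℝ (Fin d)) :
    zeroExt (u : Ω → ℝ) x = ⟪u, featureExt H x⟫ := by
  by_cases hx : x ∈ Ω
  · lift x to Ω using hx
    rw [zeroExt_coe, featureExt_coe, inner_feature]
  · rw [featureExt_of_notMem hx, inner_zero_right]
    exact Function.extend_apply' _ _ _ (by simpa using hx)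

theorem zeroExt_kern_of_mem {x y : EuclideanSpace ℝ (Fin d)} (hx : x ∈ Ω) (hy : y ∈ Ω) :
    zeroExt (fun x' => zeroExt (kern H x') y) x = ⟪featureExt H x, featureExt H y⟫ := by
  lift x to Ω using hx
  lift y to Ω using hy
  rw [zeroExt_coe, zeroExt_coe, kern_eq_inner, featureExt_coe, featureExt_coe]

/-- The diagonal derivatives of the kernel are the kernels of the iterated partial derivatives of the
feature map, all of which exist. -/
theorem iterPartial_feature (hΩ : IsOpen Ω) {m : ℕ}
    (hk : IsDiffKernelOn Ω m (fun x y => zeroExt (fun x' => zeroExt (kern H x') y) x))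
    (l : List (Fin d)) (hl : l.length ≤ m) :
    (∀ x ∈ Ω, ∀ y ∈ Ω, diagPartial l (fun x y => zeroExt (fun x' => zeroExt (kern H x') y) x) x y =
      ⟪iterPartial (featureExt H) l x, iterPartial (featureExt H) l y⟫) ∧
    (l.length < m → ∀ i, ∀ x ∈ Ω,
      LineDifferentiableAt ℝ (iterPartial (featureExt H) l) x (EuclideanSpace.single i 1)) := by
  induction l with
  | nil =>
    have h0 : ∀ x ∈ Ω, ∀ y ∈ Ω,
        diagPartial [] (fun x y => zeroExt (fun x' => zeroExt (kern H x') y) x) x y =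
        ⟪iterPartial (featureExt H) [] x, iterPartial (featureExt H) [] y⟫ :=
      fun x hx y hy => zeroExt_kern_of_mem hx hy
    refine ⟨h0, fun hm i => ?_⟩
    exact (lineDifferentiableAt_of_inner hΩ (hk.differentiable_right [] i hm)
      (hk.differentiable_left [] i hm) (hk.continuousOn [i] hm) h0).1
  | cons j l ih =>
    have hlm : l.length < m := hl
    have h0 : ∀ x ∈ Ω, ∀ y ∈ Ω,
        diagPartial (j :: l) (fun x y => zeroExt (fun x' => zeroExt (kern H x') y) x) x y =
        ⟪iterPartial (featureExt H) (j :: l) x, iterPartial (featureExt H) (j :: l) y⟫ :=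
      (lineDifferentiableAt_of_inner hΩ (hk.differentiable_right l j hlm)
        (hk.differentiable_left l j hlm) (hk.continuousOn (j :: l) hl) (ih hlm.le).1).2
    refine ⟨h0, fun hm i => ?_⟩
    exact (lineDifferentiableAt_of_inner hΩ (hk.differentiable_right (j :: l) i hm)
      (hk.differentiable_left (j :: l) i hm) (hk.continuousOn (i :: j :: l) hm) h0).1

theorem contDiffOn_featureExt (hΩ : IsOpen Ω) {m : ℕ}
    (hk : IsDiffKernelOn Ω m (fun x y => zeroExt (fun x' => zeroExt (kern H x') y) x)) :
    ContDiffOn ℝ m (featureExt H : EuclideanSpace ℝ (Fin d) → H) Ω :=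
  contDiffOn_of_iterPartial hΩ
    (fun l i hl x hx => (iterPartial_feature hΩ hk l hl.le).2 hl i x hx)
    fun l hl => continuousOn_of_inner (hk.continuousOn l hl) (iterPartial_feature hΩ hk l hl).1

theorem zeroExt_eq_comp (u : H) :
    zeroExt (u : Ω → ℝ) = innerSL ℝ u ∘ (featureExt H : EuclideanSpace ℝ (Fin d) → H) :=
  funext fun x => zeroExt_eq_inner u x

variable {m : ℕ} {M D : ℝ}

theorem IsRich.contDiffAt (hH : IsRich H m M D) (hΩ : IsOpen Ω) (u : H)
    {x : EuclideanSpace ℝ (Fin d)} (hx : x ∈ Ω) : ContDiffAt ℝ m (zeroExt (u : Ω → ℝ)) x := by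
  rw [zeroExt_eq_comp]
  exact (innerSL ℝ u).contDiff.contDiffAt.comp x
    ((contDiffOn_featureExt hΩ hH.kernel_diff).contDiffAt (hΩ.mem_nhds hx))

/-- Derivatives of order `m` are bounded functionals, of norm at most `D`. -/
theorem IsRich.abs_partialDeriv_le (hH : IsRich H m M D) (hΩ : IsOpen Ω) (u : H)
    (I : Fin m → Fin d) {x : EuclideanSpace ℝ (Fin d)} (hx : x ∈ Ω) :
    |partialDeriv I (zeroExt (u : Ω → ℝ)) x| ≤ D * ‖u‖ := by
  have hc := contDiffOn_featureExt hΩ hH.kernel_diff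
  have hlen : (List.ofFn I).length = m := List.length_ofFn
  rw [partialDeriv, zeroExt_eq_comp, (innerSL ℝ u).iteratedFDeriv_comp_left
    (hc.contDiffAt (hΩ.mem_nhds hx)) le_rfl, ContinuousLinearMap.compContinuousMultilinearMap_coe,
    Function.comp_apply, iteratedFDeriv_single_eq_iterPartial hΩ hc le_rfl I hx, innerSL_apply_apply]
  refine (abs_real_inner_le_norm _ _).trans ?_
  rw [mul_comm]
  refine mul_le_mul_of_nonneg_right ?_ (norm_nonneg u)
  have hb := hH.kernel_bound _ hlen x hx x hx
  rw [(iterPartial_feature hΩ hH.kernel_diff _ hlen.le).1 x hx x hx, real_inner_self_eq_norm_sq,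
    abs_of_nonneg (sq_nonneg _)] at hb
  exact le_of_abs_le (abs_le_of_sq_le_sq hb (zero_le_one.trans hH.one_le_D))

theorem IsRich.continuous_coe (hH : IsRich H m M D) (hΩ : IsOpen Ω) (u : H) :
    Continuous (u : Ω → ℝ) := by
  have h : ContinuousOn (zeroExt (u : Ω → ℝ)) Ω := fun x hx =>
    (hH.contDiffAt hΩ u hx).continuousAt.continuousWithinAt
  refine (continuousOn_iff_continuous_domRestrict.1 h).congr fun x => zeroExt_coe _ x

theorem partialDeriv_congr {u v : EuclideanSpace ℝ (Fin d) → ℝ} {x : EuclideanSpace ℝ (Fin d)}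
    (h : u =ᶠ[nhds x] v) (I : Fin m → Fin d) : partialDeriv I u x = partialDeriv I v x := by
  rw [partialDeriv, partialDeriv, (Filter.EventuallyEq.iteratedFDeriv ℝ h m).self_of_nhds]

theorem abs_partialDeriv_le_seminormOn {f : EuclideanSpace ℝ (Fin d) → ℝ} {C : ℝ}
    (hC : ∀ (I : Fin m → Fin d), ∀ x ∈ Ω, |partialDeriv I f x| ≤ C) (I : Fin m → Fin d)
    {x : EuclideanSpace ℝ (Fin d)} (hx : x ∈ Ω) : |partialDeriv I f x| ≤ seminormOn Ω m f :=
  (le_ciSup (f := fun x : Ω => |partialDeriv I f x|)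
    ⟨C, by rintro _ ⟨y, rfl⟩; exact hC I y y.2⟩ ⟨x, hx⟩).trans
    (le_ciSup (f := fun I : Fin m → Fin d => ⨆ x : Ω, |partialDeriv I f x|)
      (Set.finite_range _).bddAbove I)

theorem exists_norm_sub_le_fillDistance {n : ℕ} (hn : 0 < n) (hΩ : Bornology.IsBounded Ω)
    (x : Fin n → Ω) {w : EuclideanSpace ℝ (Fin d)} (hw : w ∈ Ω) :
    ∃ i, ‖w - x i‖ ≤ fillDistance Ω x := by
  have : Nonempty (Fin n) := ⟨⟨0, hn⟩⟩
  obtain ⟨i, hi⟩ := exists_eq_ciInf_of_finite (f := fun i => ‖w - x i‖)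
  refine ⟨i, hi.trans_le ?_⟩
  obtain ⟨C, hC⟩ := Metric.isBounded_iff.1 hΩ
  refine le_ciSup (f := fun z : Ω => ⨅ i : Fin n, ‖(z : EuclideanSpace ℝ (Fin d)) - x i‖)
    ⟨C, ?_⟩ ⟨w, hw⟩
  rintro _ ⟨z, rfl⟩
  refine (ciInf_le ⟨0, ?_⟩ ⟨0, hn⟩).trans ((dist_eq_norm _ _).symm.trans_le (hC z.2 (x ⟨0, hn⟩).2))
  rintro _ ⟨j, rfl⟩
  exact norm_nonneg _

/-- If `f - c` agrees with a function `w` of the space at the data sites, then it agrees with `w`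
everywhere up to a sampling error. The constant `c` does not contribute, as `m` is positive. -/
theorem IsRich.abs_sub_le_of_eq_at_sites (hH : IsRich H m M D) (hd : 0 < d) (hm : 0 < m) {r : ℝ}
    (hΩ : IsUnionOfBalls Ω r) {n : ℕ} (hn : 0 < n) (x : Fin n → Ω)
    (hh : fillDistance Ω x ≤ r / max 1 (18 * ((m : ℝ) - 1) ^ 2))
    {f : EuclideanSpace ℝ (Fin d) → ℝ} (hf : ∃ u : H, ∀ x : Ω, u x = f x) {c : ℝ} {w : H}
    (hw : ∀ i, f (x i) - c = w (x i)) (y : Ω) :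
    |f y - c - w y| ≤ constC d m * fillDistance Ω x ^ m * (seminormOn Ω m f + D * ‖w‖) := by
  have hΩo := hΩ.isOpen
  obtain ⟨u, hu⟩ := hf
  have hfu : Set.EqOn f (zeroExt (u : Ω → ℝ)) Ω := fun z hz => by
    rw [zeroExt_of_mem _ hz, hu]
  have hfu' : ∀ z ∈ Ω, f =ᶠ[nhds z] zeroExt (u : Ω → ℝ) := fun z hz =>
    hfu.eventuallyEq_of_mem (hΩo.mem_nhds hz)
  have hfc : ∀ z ∈ Ω, ContDiffAt ℝ m f z := fun z hz =>
    (hH.contDiffAt hΩo u hz).congr_of_eventuallyEq (hfu' z hz)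
  have hfb := fun I => fun z (hz : z ∈ Ω) => abs_partialDeriv_le_seminormOn (m := m) (f := f)
    (C := D * ‖u‖) (fun I z hz => by
      rw [partialDeriv_congr (hfu' z hz)]; exact hH.abs_partialDeriv_le hΩo u I hz) I hz
  have hD : 0 ≤ D := zero_le_one.trans hH.one_le_D
  set g : EuclideanSpace ℝ (Fin d) → ℝ := fun z => f z - zeroExt (w : Ω → ℝ) z - c with hg
  have hgc : ∀ z ∈ Ω, ContDiffAt ℝ m g z := fun z hz =>
    ((hfc z hz).sub (hH.contDiffAt hΩo w hz)).sub contDiffAt_const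
  have hgb : ∀ (I : Fin m → Fin d), ∀ z ∈ Ω, |partialDeriv I g z| ≤
      seminormOn Ω m f + D * ‖w‖ := by
    intro I z hz
    have e : partialDeriv I g z = partialDeriv I f z - partialDeriv I (zeroExt (w : Ω → ℝ)) z := by
      have e1 := iteratedFDeriv_sub_apply (f := f - zeroExt (w : Ω → ℝ)) ((hfc z hz).sub (hH.contDiffAt hΩo w hz))
        (contDiffAt_const (c := c) (n := m) (𝕜 := ℝ))
      have e2 := iteratedFDeriv_sub_apply (hfc z hz) (hH.contDiffAt hΩo w hz)
      rw [partialDeriv, show g = (f - zeroExt (w : Ω → ℝ)) - fun _ => c from rfl, e1,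
        iteratedFDeriv_const_of_ne hm.ne', e2]
      simp [partialDeriv]
    rw [e]
    exact (abs_sub _ _).trans (add_le_add (hfb I z hz) (hH.abs_partialDeriv_le hΩo w I hz))
  have hC0 : 0 ≤ seminormOn Ω m f + D * ‖w‖ :=
    (abs_nonneg _).trans (hgb (fun _ => ⟨0, hd⟩) y y.2)
  have hfd : 0 ≤ fillDistance Ω x :=
    (norm_nonneg _).trans (exists_norm_sub_le_fillDistance hn hΩ.isBounded x y.2).choose_spec
  have := abs_le_of_vanishing hd hm hΩ hgc hC0 hgb
    (Y := Set.range fun i => (x i : EuclideanSpace ℝ (Fin d)))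
    (by rintro _ ⟨i, rfl⟩; exact (x i).2)
    (by
      rintro _ ⟨i, rfl⟩
      simp only [hg]
      rw [zeroExt_coe, ← hw]; ring) hfd hh
    (fun z hz => by simpa using exists_norm_sub_le_fillDistance hn hΩ.isBounded x hz) y.2
  rw [hg] at this
  simp only [zeroExt_coe] at this
  rwa [sub_right_comm] at this

end Regularity

end KernelSOS

namespace KernelSOS

open Matrix

/-! ### Quadratic forms of matrices -/

section MatrixForms

variable {n : ℕ}

theorem dotProduct_mulVec_eq_sum (B : Matrix (Fin n) (Fin n) ℝ) (v : Fin n → ℝ) :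
    v ⬝ᵥ B *ᵥ v = ∑ j, ∑ l, v j * v l * B j l := by
  simp only [dotProduct, mulVec, Finset.mul_sum]
  exact Finset.sum_congr rfl fun j _ => Finset.sum_congr rfl fun l _ => by ring

theorem _root_.Matrix.PosSemidef.exists_real_sum {B : Matrix (Fin n) (Fin n) ℝ}
    (hB : B.PosSemidef) : ∃ (p : ℕ) (a : Fin p → Fin n → ℝ), ∀ i j, B i j = ∑ l, a l i * a l j := by
  obtain ⟨p, a, ha⟩ := posSemidef_iff_eq_sum_vecMulVec.mp hB
  refine ⟨p, a, fun i j => ?_⟩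
  rw [ha]
  simp [Matrix.sum_apply, vecMulVec_apply]

theorem _root_.Matrix.PosSemidef.abs_apply_le_trace {B : Matrix (Fin n) (Fin n) ℝ}
    (hB : B.PosSemidef) (i j : Fin n) : |B i j| ≤ B.trace := by
  obtain ⟨p, a, ha⟩ := hB.exists_real_sum
  have hdiag : ∀ i, B i i ≤ B.trace := fun i =>
    Finset.single_le_sum (f := fun i => B i i)
      (fun i _ => by simp only [ha]; exact Finset.sum_nonneg fun l _ => mul_self_nonneg _)
      (Finset.mem_univ i)
  have h : |B i j| ≤ (B i i + B j j) / 2 := by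
    simp only [ha]
    rw [← Finset.sum_add_distrib, Finset.sum_div]
    refine (Finset.abs_sum_le_sum_abs _ _).trans (Finset.sum_le_sum fun l _ => ?_)
    rw [abs_le]
    constructor <;> nlinarith [sq_nonneg (a l i - a l j), sq_nonneg (a l i + a l j)]
  linarith [hdiag i, hdiag j]

theorem isClosed_setOf_posSemidef : IsClosed {B : Matrix (Fin n) (Fin n) ℝ | B.PosSemidef} := by
  simp only [posSemidef_iff_dotProduct_mulVec, Set.ofPred_and, Set.ofPred_forall]
  refine IsClosed.inter ?_ (isClosed_iInter fun v => ?_)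
  · exact isClosed_eq (by fun_prop) continuous_id
  · exact isClosed_le continuous_const (by fun_prop)

end MatrixForms

theorem _root_.Orthonormal.eq_sum_inner_of_mem_span {V : Type*}
    [NormedAddCommGroup V] [InnerProductSpace ℝ V] {n : ℕ} {e : Fin n → V}
    (he : Orthonormal ℝ e) {v : V} (hv : v ∈ Submodule.span ℝ (Set.range e)) :
    v = ∑ k, ⟪e k, v⟫ • e k := by
  obtain ⟨c, rfl⟩ := (Submodule.mem_span_range_iff_exists_fun ℝ).1 hv
  simp_rw [he.inner_right_fintype]

/-! ### The Cholesky factor and existence of solutions of the semidefinite program -/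

section SDP

variable {d : ℕ} {Ω : Set (EuclideanSpace ℝ (Fin d))}

theorem IsCholesky.isUnit_det {n : ℕ} {K R : Matrix (Fin n) (Fin n) ℝ} (h : IsCholesky K R) :
    IsUnit R.det := by
  rw [det_of_isUpperTriangular h.1]
  exact (Finset.prod_pos fun i _ => h.2.1 i).ne'.isUnit

/-- The program always has feasible points: the values of the quadratic form at the columns of an
invertible matrix can be prescribed freely. -/
theorem exists_isSDPFeasible {n : ℕ} {R : Matrix (Fin n) (Fin n) ℝ} (hR : IsUnit R.det)
    (f : EuclideanSpace ℝ (Fin d) → ℝ) (x : Fin n → Ω) {c : ℝ} (hc : ∀ i, c ≤ f (x i)) :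
    ∃ B, IsSDPFeasible f x R c B := by
  set T : Matrix (Fin n) (Fin n) ℝ := diagonal fun i => f (x i) - c with hT
  refine ⟨(R⁻¹)ᴴ * T * R⁻¹, ?_, fun i => ?_⟩
  · exact (PosSemidef.diagonal fun i => sub_nonneg.2 (hc i)).conjTranspose_mul_mul_same _
  · have h1 : R⁻¹ *ᵥ R.col i = Pi.single i 1 := by
      have : R.col i = R *ᵥ Pi.single i 1 := by simp
      rw [this, mulVec_mulVec, nonsing_inv_mul _ hR, one_mulVec]
    rw [← mulVec_mulVec, ← mulVec_mulVec, h1, dotProduct_mulVec, vecMul_conjTranspose]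
    simp [h1, hT]

theorem exists_isSDPSolution {n : ℕ} (hn : 0 < n) {R : Matrix (Fin n) (Fin n) ℝ}
    (hR : IsUnit R.det) (f : EuclideanSpace ℝ (Fin d) → ℝ) (x : Fin n → Ω) {lam : ℝ}
    (hlam : 0 < lam) : ∃ c B, IsSDPSolution f x R lam c B := by
  have : Nonempty (Fin n) := ⟨⟨0, hn⟩⟩
  obtain ⟨i₀, hi₀⟩ := Finite.exists_min fun i => f (x i)
  obtain ⟨B₀, hB₀⟩ := exists_isSDPFeasible hR f x hi₀
  have hcle : ∀ c B, IsSDPFeasible f x R c B → c ≤ f (x i₀) := by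
    intro c B h
    have h1 := h.2 i₀
    have h2 := h.1.dotProduct_mulVec_nonneg (R.col i₀)
    rw [star_trivial] at h2
    linarith
  set v₀ : ℝ := f (x i₀) - lam * B₀.trace with hv₀
  set T : ℝ := (f (x i₀) - v₀) / lam with hT
  set S : Set (ℝ × Matrix (Fin n) (Fin n) ℝ) :=
    {p | IsSDPFeasible f x R p.1 p.2 ∧ v₀ ≤ p.1 - lam * p.2.trace} with hS
  have hclosed : IsClosed S := by
    simp only [hS, IsSDPFeasible, Set.ofPred_and, Set.ofPred_forall]
    refine IsClosed.inter (IsClosed.inter ?_ (isClosed_iInter fun i => ?_)) ?_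
    · exact isClosed_setOf_posSemidef.preimage continuous_snd
    · exact isClosed_eq (by fun_prop) (by fun_prop)
    · exact isClosed_le continuous_const (by fun_prop)
  have hbig : IsCompact (Set.Icc v₀ (f (x i₀)) ×ˢ
      (Set.univ.pi fun _ => Set.univ.pi fun _ => Set.Icc (-T) T :
        Set (Matrix (Fin n) (Fin n) ℝ))) :=
    isCompact_Icc.prod (isCompact_univ_pi fun _ => isCompact_univ_pi fun _ => isCompact_Icc)
  have hcomp : IsCompact S := by
    refine hbig.of_isClosed_subset hclosed ?_
    rintro ⟨c, (B : Matrix (Fin n) (Fin n) ℝ)⟩ ⟨hf, hv⟩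
    have hc := hcle c B hf
    have htr : 0 ≤ B.trace := (abs_nonneg _).trans (hf.1.abs_apply_le_trace i₀ i₀)
    simp only at hv
    have hlt : 0 ≤ lam * B.trace := by positivity
    refine ⟨⟨by linarith, hc⟩, fun i _ j _ => abs_le.1 ((hf.1.abs_apply_le_trace i j).trans ?_)⟩
    rw [hT, le_div_iff₀ hlam]
    linarith
  obtain ⟨⟨c, B⟩, hmem, hmax⟩ := hcomp.exists_isMaxOn ⟨(f (x i₀), B₀), hB₀, le_rfl⟩
    (f := fun p : ℝ × Matrix (Fin n) (Fin n) ℝ => p.1 - lam * p.2.trace)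
    (Continuous.continuousOn (by fun_prop))
  refine ⟨c, B, hmem.1, fun c' B' h' => ?_⟩
  by_cases hv : v₀ ≤ c' - lam * B'.trace
  · exact hmax (a := (c', B')) ⟨h', hv⟩
  · exact (not_le.1 hv).le.trans hmem.2

variable {H : Type*} [NormedAddCommGroup H] [InnerProductSpace ℝ H] [CompleteSpace H]
  [RKHS ℝ H Ω ℝ] {m : ℕ} {M D : ℝ}

theorem IsRich.linearIndependent_feature (hH : IsRich H m M D) {n : ℕ} {x : Fin n → Ω}
    (hx : Function.Injective x) : LinearIndependent ℝ fun i => feature H (x i) := by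
  rw [Fintype.linearIndependent_iff]
  intro c hc j
  -- A smooth function vanishing at all the points but the `j`-th.
  obtain ⟨u, hu⟩ := hH.smooth_mem
    (fun y => ∏ i ∈ Finset.univ.erase j, ‖y - (x i : EuclideanSpace ℝ (Fin d))‖ ^ 2)
    (contDiff_prod fun i _ => (contDiff_id.sub contDiff_const).norm_sq ℝ)
  have h1 : ∑ i, c i * u (x i) = 0 := by
    have := congrArg (fun v => ⟪u, v⟫) hc
    simpa [inner_sum, inner_smul_right, inner_feature] using this
  rw [Finset.sum_eq_single j] at h1
  · refine (mul_eq_zero.1 h1).resolve_right ?_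
    rw [hu]
    refine Finset.prod_ne_zero_iff.2 fun i hi => ?_
    have : x j ≠ x i := fun h => (Finset.ne_of_mem_erase hi) (hx h).symm
    have : (x j : EuclideanSpace ℝ (Fin d)) - x i ≠ 0 := sub_ne_zero.2 (Subtype.coe_injective.ne this)
    positivity
  · intro i _ hij
    rw [hu, Finset.prod_eq_zero (Finset.mem_erase.2 ⟨hij, Finset.mem_univ i⟩) (by simp), mul_zero]
  · simp

/-- Gram matrices of linearly independent families have Cholesky factors, by the Gram–Schmidt
process. -/
theorem exists_isCholesky {n : ℕ} {x : Fin n → Ω}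
    (hli : LinearIndependent ℝ fun i => feature H (x i)) :
    ∃ R, IsCholesky (kernelMatrix H x) R := by
  set v : Fin n → H := fun i => feature H (x i) with hv
  set e := InnerProductSpace.gramSchmidtNormed ℝ v with he
  have heo : Orthonormal ℝ e := InnerProductSpace.gramSchmidtNormed_orthonormal hli
  have hspan : ∀ i, v i ∈ Submodule.span ℝ (Set.range e) := fun i => by
    rw [he, InnerProductSpace.span_gramSchmidtNormed_range, InnerProductSpace.span_gramSchmidt]
    exact Submodule.subset_span ⟨i, rfl⟩
  refine ⟨Matrix.of fun i j => ⟪e i, v j⟫, ?_, ?_, ?_⟩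
  · intro i j hij
    simp only [of_apply, he, InnerProductSpace.gramSchmidtNormed, inner_smul_left]
    rw [InnerProductSpace.gramSchmidt_inv_triangular ℝ v (i := j) (j := i) hij, mul_zero]
  · intro i
    have hne := InnerProductSpace.gramSchmidt_ne_zero i hli
    have hpos : 0 < ‖InnerProductSpace.gramSchmidt ℝ v i‖ := norm_pos_iff.2 hne
    have h1 : ⟪InnerProductSpace.gramSchmidt ℝ v i, v i⟫ =
        ‖InnerProductSpace.gramSchmidt ℝ v i‖ ^ 2 := by
      conv_lhs => rw [InnerProductSpace.gramSchmidt_def'' ℝ v i]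
      rw [inner_add_right, inner_sum, Finset.sum_eq_zero, add_zero, real_inner_self_eq_norm_sq]
      · intro k hk
        rw [inner_smul_right, InnerProductSpace.gramSchmidt_orthogonal ℝ v
          (Finset.mem_Iio.1 hk).ne', mul_zero]
    simp only [of_apply, he, InnerProductSpace.gramSchmidtNormed, inner_smul_left, h1]
    simp only [RCLike.ofReal_real_eq_id, id_eq, map_inv₀, conj_trivial]
    positivity
  · ext i j
    rw [kernelMatrix, of_apply, kern_eq_inner, mul_apply]
    change ⟪v i, v j⟫ = _
    conv_lhs => rw [heo.eq_sum_inner_of_mem_span (hspan i), sum_inner]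
    refine Finset.sum_congr rfl fun k _ => ?_
    rw [inner_smul_left, transpose_apply, of_apply, of_apply, RCLike.conj_to_real]

/-- A Cholesky factor holds the coordinates of the features in an orthonormal family. -/
theorem IsCholesky.exists_orthonormal {n : ℕ} {x : Fin n → Ω} {R : Matrix (Fin n) (Fin n) ℝ}
    (hR : IsCholesky (kernelMatrix H x) R) :
    ∃ e : Fin n → H, Orthonormal ℝ e ∧ ∀ i, feature H (x i) = ∑ j, R j i • e j := by
  have hu := hR.isUnit_det
  refine ⟨fun j => ∑ i, R⁻¹ i j • feature H (x i), ?_, fun i => ?_⟩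
  · rw [orthonormal_iff_ite]
    intro j l
    have h1 : ⟪∑ i, R⁻¹ i j • feature H (x i), ∑ i, R⁻¹ i l • feature H (x i)⟫ =
        ((R⁻¹)ᵀ * kernelMatrix H x * R⁻¹) j l := by
      rw [Matrix.mul_assoc, mul_apply, sum_inner]
      refine Finset.sum_congr rfl fun i _ => ?_
      rw [inner_sum, mul_apply, transpose_apply, Finset.mul_sum]
      refine Finset.sum_congr rfl fun k _ => ?_
      rw [inner_smul_left, inner_smul_right, kernelMatrix, of_apply, kern_eq_inner,
        RCLike.conj_to_real]
      ring
    rw [h1, hR.2.2, Matrix.mul_assoc, Matrix.mul_assoc, mul_nonsing_inv _ hu, Matrix.mul_one,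
      ← transpose_mul, mul_nonsing_inv _ hu, transpose_one, one_apply]
  · simp_rw [Finset.smul_sum, smul_smul]
    rw [Finset.sum_comm]
    simp_rw [← Finset.sum_smul]
    have h2 : ∀ k, ∑ j, R j i * R⁻¹ k j = (1 : Matrix (Fin n) (Fin n) ℝ) k i := fun k => by
      rw [← nonsing_inv_mul _ hu, mul_apply]
      exact Finset.sum_congr rfl fun j _ => mul_comm _ _
    simp_rw [h2, one_apply, ite_smul, one_smul, zero_smul]
    simp

/-- Compressing a feasible operator of the infinite-dimensional problem gives a feasible matrix
of no larger trace. -/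
theorem IsFeasible.exists_isSDPFeasible {f : EuclideanSpace ℝ (Fin d) → ℝ} {c : ℝ} {A : H →L[ℝ] H}
    (hA : IsFeasible H f c A) (hfin : HasFiniteTrace A) {n : ℕ} {x : Fin n → Ω}
    {R : Matrix (Fin n) (Fin n) ℝ} (hR : IsCholesky (kernelMatrix H x) R) :
    ∃ B, IsSDPFeasible f x R c B ∧ B.trace ≤ opTrace A := by
  obtain ⟨e, he, hφ⟩ := hR.exists_orthonormal
  have hq : ∀ v : Fin n → ℝ, v ⬝ᵥ (Matrix.of fun j l => ⟪e j, A (e l)⟫) *ᵥ v =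
      ⟪∑ j, v j • e j, A (∑ j, v j • e j)⟫ := by
    intro v
    rw [dotProduct_mulVec_eq_sum, map_sum, sum_inner]
    refine Finset.sum_congr rfl fun j _ => ?_
    rw [inner_sum]
    refine Finset.sum_congr rfl fun l _ => ?_
    rw [map_smul, inner_smul_left, inner_smul_right, RCLike.conj_to_real, of_apply]
    ring
  refine ⟨Matrix.of fun j l => ⟪e j, A (e l)⟫, ⟨?_, fun i => ?_⟩, ?_⟩
  · refine PosSemidef.of_dotProduct_mulVec_nonneg ?_ fun v => ?_
    · ext j l
      rw [conjTranspose_apply, of_apply, of_apply, star_trivial, real_inner_comm]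
      exact hA.1.isSymmetric _ _
    · rw [star_trivial, hq]
      exact hA.1.inner_nonneg_right _
  · rw [hA.2, hq, hφ]
    rfl
  · exact sum_inner_le_of_orthonormal (someBasis H) hA.1 hfin.hasSum he Finset.univ

/-- The quadratic form of a positive semidefinite matrix `B` at the feature vectors extends to a
nonnegative function of the space, with norm at most `M tr B`. -/
theorem IsRich.exists_eq_quadratic (hH : IsRich H m M D) {n : ℕ} {x : Fin n → Ω}
    {R B : Matrix (Fin n) (Fin n) ℝ} (hR : IsCholesky (kernelMatrix H x) R) (hB : B.PosSemidef) :
    ∃ w : H, (∀ y, 0 ≤ w y) ∧ (∀ i, w (x i) = R.col i ⬝ᵥ B *ᵥ R.col i) ∧ ‖w‖ ≤ M * B.trace := by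
  obtain ⟨e, he, hφ⟩ := hR.exists_orthonormal
  obtain ⟨p, a, ha⟩ := hB.exists_real_sum
  choose w hw hwn using fun l => hH.mul_mem (∑ j, a l j • e j) (∑ j, a l j • e j)
  have hsum : ∀ y, (∑ l, w l : H) y = ∑ l, w l y := fun y => by
    rw [← inner_feature, sum_inner]
    exact Finset.sum_congr rfl fun l _ => inner_feature H _ _
  refine ⟨∑ l, w l, fun y => ?_, fun i => ?_, ?_⟩
  · rw [hsum]
    exact Finset.sum_nonneg fun l _ => by rw [hw]; exact mul_self_nonneg _
  · have hv : ∀ l, (∑ j, a l j • e j : H) (x i) = ∑ j, a l j * R j i := fun l => by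
      rw [← inner_feature, hφ, he.inner_sum]
      simp
    rw [hsum, dotProduct_mulVec_eq_sum]
    simp_rw [hw, hv, ha, Finset.sum_mul_sum, Finset.mul_sum]
    rw [Finset.sum_comm]
    refine Finset.sum_congr rfl fun j _ => ?_
    rw [Finset.sum_comm]
    refine Finset.sum_congr rfl fun k _ => Finset.sum_congr rfl fun l _ => ?_
    rw [col_apply, col_apply]
    ring
  · refine (norm_sum_le _ _).trans ?_
    have hn : ∀ l, ‖∑ j, a l j • e j‖ ^ 2 = ∑ j, a l j * a l j := fun l => by
      rw [← real_inner_self_eq_norm_sq, he.inner_sum]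
      simp
    calc ∑ l, ‖w l‖ ≤ ∑ l, M * ∑ j, a l j * a l j := Finset.sum_le_sum fun l _ => by
          rw [← hn, sq, ← mul_assoc]; exact hwn l
      _ = M * B.trace := by
          rw [← Finset.mul_sum, Finset.sum_comm, trace]
          simp [ha]

end SDP

end KernelSOS

namespace KernelSOS

open Filter Topology

/-! ### A smooth square root near a positive definite matrix -/

/-- A local square root in a Banach algebra near `1`, from the inverse function theorem. By local
uniqueness it is fixed by every involution-like map that fixes its argument. -/
theorem exists_local_sqrt {𝔸 : Type*} [NormedRing 𝔸] [NormedAlgebra ℝ 𝔸] [CompleteSpace 𝔸]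
    {σ : 𝔸 → 𝔸} (hσ : Continuous σ) (hσ1 : σ 1 = 1) (hσm : ∀ X, σ (X * X) = σ X * σ X) :
    ∃ g : 𝔸 → 𝔸, ContDiffAt ℝ ω g 1 ∧
      ∀ᶠ Q in 𝓝 1, g Q * g Q = Q ∧ (σ Q = Q → σ (g Q) = g Q) := by
  set s : 𝔸 → 𝔸 := fun X => X * X with hs
  have hc : ContDiffAt ℝ ω s 1 := (contDiff_id.mul contDiff_id).contDiffAt
  set f' : 𝔸 ≃L[ℝ] 𝔸 := ContinuousLinearEquiv.smulLeft (Units.mk0 (2 : ℝ) two_ne_zero) with hf'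
  have hd : HasFDerivAt s (f' : 𝔸 →L[ℝ] 𝔸) 1 := by
    have h : HasFDerivAt s _ 1 :=
      (hasFDerivAt_id (𝕜 := ℝ) (1 : 𝔸)).mul' (hasFDerivAt_id (𝕜 := ℝ) (1 : 𝔸))
    refine h.congr_fderiv ?_
    ext X
    simp [hf', two_smul, Units.smul_def]
  set e := hc.toOpenPartialHomeomorph s hd (by simp) with he
  have h1s : (1 : 𝔸) ∈ e.source := hc.mem_toOpenPartialHomeomorph_source hd (by simp)
  have hcoe : ∀ X, e X = X * X := fun X => rfl
  have e1 : e 1 = 1 := by rw [hcoe, one_mul]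
  have h1t : (1 : 𝔸) ∈ e.target := by simpa [e1] using e.map_source h1s
  have hg1 : e.symm 1 = 1 := by simpa [e1] using e.left_inv h1s
  have hgc : ContDiffAt ℝ ω e.symm 1 := by
    have := hc.to_localInverse hd (by simp)
    rwa [show s 1 = 1 from e1] at this
  refine ⟨e.symm, hgc, ?_⟩
  have hσg : Tendsto (fun Q => σ (e.symm Q)) (𝓝 1) (𝓝 1) := by
    have := (hσ.tendsto (e.symm 1)).comp hgc.continuousAt.tendsto
    rwa [hg1, hσ1] at this
  filter_upwards [e.eventually_right_inverse h1t, hσg.eventually (e.eventually_left_inverse h1s)]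
    with Q hQ hQσ
  rw [hcoe] at hQ
  refine ⟨hQ, fun h => ?_⟩
  rw [← hQσ, hcoe, ← hσm, hQ, h]

/-- A germ extends to a global smooth function. Regularity `ω` is assumed because it spreads to a
neighbourhood, unlike regularity `∞` at a point. -/
theorem exists_contDiff_eventuallyEq {W : Type*} [NormedAddCommGroup W] [NormedSpace ℝ W]
    [FiniteDimensional ℝ W] {f : W → ℝ} {p : W} (hf : ContDiffAt ℝ ω f p) :
    ∃ a : W → ℝ, ContDiff ℝ ∞ a ∧ a =ᶠ[𝓝 p] f := by
  obtain ⟨ε, hε, hball⟩ := Metric.eventually_nhds_iff_ball.1 (hf.eventually (by decide))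
  set χ : ContDiffBump p := ⟨ε / 3, ε / 2, by positivity, by linarith⟩ with hχ
  refine ⟨fun x => χ x * f x, contDiff_iff_contDiffAt.2 fun y => ?_, ?_⟩
  · by_cases hy : y ∈ Metric.ball p ε
    · exact χ.contDiffAt.mul ((hball y hy).of_le le_top)
    · have hy' : y ∉ tsupport χ := by
        rw [χ.tsupport_eq, Metric.mem_closedBall]
        rw [Metric.mem_ball] at hy
        change ¬ dist y p ≤ ε / 2
        linarith
      refine (contDiffAt_const (c := (0 : ℝ))).congr_of_eventuallyEq ?_
      filter_upwards [notMem_tsupport_iff_eventuallyEq.1 hy'] with x hx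
      rw [hx, Pi.zero_apply, zero_mul]
  · filter_upwards [χ.eventuallyEq_one] with x hx
    rw [hx, Pi.one_apply, one_mul]

section
open Matrix
open scoped Matrix.Norms.Operator MatrixOrder

/-- Near a positive definite matrix, a quadratic form in `d` variables is a sum of `d` squares of
linear forms whose coefficients are smooth functions of the matrix. -/
theorem exists_smooth_squares {d : ℕ} {P : Matrix (Fin d) (Fin d) ℝ} (hP : P.PosDef) :
    ∃ a : Fin d → Fin d → (Fin d × Fin d → ℝ) → ℝ, (∀ k l, ContDiff ℝ ∞ (a k l)) ∧
      ∀ᶠ V in 𝓝 (fun ij : Fin d × Fin d => P ij.1 ij.2), ∀ y : Fin d → ℝ,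
        ∑ ij : Fin d × Fin d, V ij * (y ij.1 * y ij.2) = ∑ k, (∑ l, a k l V * y l) ^ 2 := by
  obtain ⟨S, hS⟩ := CStarAlgebra.nonneg_iff_eq_star_mul_self.mp hP.posSemidef.nonneg
  have hu : IsUnit P.det := hP.det_pos.ne'.isUnit
  have hPt : Pᵀ = P := by simpa using hP.1.eq
  have hPit : (P⁻¹)ᵀ = P⁻¹ := by rw [transpose_nonsing_inv, hPt]
  -- `X = (P⁻¹ V)^{1/2}` is self-adjoint for the form `P`, so that `V = P X² = Xᵀ P X = (S X)ᵀ (S X)`.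
  set σ : Matrix (Fin d) (Fin d) ℝ → Matrix (Fin d) (Fin d) ℝ := fun X => P⁻¹ * Xᵀ * P with hσ
  have hPP : P * P⁻¹ = 1 := mul_nonsing_inv _ hu
  have hPP' : P⁻¹ * P = 1 := nonsing_inv_mul _ hu
  obtain ⟨g, hg, hgs⟩ := exists_local_sqrt (σ := σ) (by fun_prop)
    (by simp only [hσ, transpose_one, Matrix.mul_one, hPP'])
    (fun X => by
      simp only [hσ, transpose_mul]
      calc P⁻¹ * (Xᵀ * Xᵀ) * P = P⁻¹ * Xᵀ * (1 : Matrix (Fin d) (Fin d) ℝ) * Xᵀ * P := by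
            simp only [Matrix.mul_one, Matrix.mul_assoc]
        _ = _ := by rw [← hPP]; simp only [Matrix.mul_assoc])
  -- The symmetric matrix of the quadratic form with coefficients `V`.
  set sym : (Fin d × Fin d → ℝ) →ₗ[ℝ] Matrix (Fin d) (Fin d) ℝ :=
    { toFun := fun V => Matrix.of fun i j => (V (i, j) + V (j, i)) / 2
      map_add' := fun V W => by ext i j; simp; ring
      map_smul' := fun c V => by ext i j; simp; ring } with hsym
  set q : (Fin d × Fin d → ℝ) →ₗ[ℝ] Matrix (Fin d) (Fin d) ℝ :=
    (LinearMap.mulLeft ℝ P⁻¹) ∘ₗ sym with hq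
  have hqc : ContDiff ℝ ω q := (LinearMap.toContinuousLinearMap q).contDiff
  set V₀ : Fin d × Fin d → ℝ := fun ij => P ij.1 ij.2 with hV₀
  have hsymV₀ : sym V₀ = P := by
    ext i j
    have : P j i = P i j := congrFun (congrFun hPt i) j
    simp [hsym, hV₀, this]
  have hqV₀ : q V₀ = 1 := by simp [hq, hsymV₀, hPP']
  have hcoef : ∀ k l, ContDiffAt ℝ ω (fun V => (S * g (q V)) k l) V₀ := by
    intro k l
    have h1 : ContDiffAt ℝ ω (fun V => g (q V)) V₀ := by
      refine ContDiffAt.comp (g := g) (f := fun V => q V) V₀ ?_ hqc.contDiffAt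
      rwa [hqV₀]
    set L : Matrix (Fin d) (Fin d) ℝ →ₗ[ℝ] ℝ :=
      (Matrix.entryLinearMap ℝ ℝ k l) ∘ₗ (LinearMap.mulLeft ℝ S)
    exact (LinearMap.toContinuousLinearMap L).contDiff.contDiffAt.comp V₀ h1
  choose a ha haf using fun k l => exists_contDiff_eventuallyEq (hcoef k l)
  refine ⟨a, ha, ?_⟩
  have hq1 : Tendsto q (𝓝 V₀) (𝓝 1) := by
    have := hqc.continuous.tendsto V₀
    rwa [hqV₀] at this
  filter_upwards [hq1.eventually hgs, eventually_all.2 fun k => eventually_all.2 fun l => haf k l]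
    with V hV haV y
  obtain ⟨hsq, hfix⟩ := hV
  set X := g (q V) with hX
  have hst : (sym V)ᵀ = sym V := by
    ext i j
    simp [hsym, add_comm]
  have hPq : P * q V = sym V := by
    simp only [hq, LinearMap.comp_apply, LinearMap.mulLeft_apply]
    rw [← Matrix.mul_assoc, hPP, Matrix.one_mul]
  have hσX : P⁻¹ * Xᵀ * P = X := hfix <| by
    simp only [hσ, hq, LinearMap.comp_apply, LinearMap.mulLeft_apply, transpose_mul, hst, hPit]
    rw [Matrix.mul_assoc, Matrix.mul_assoc, hPP', Matrix.mul_one]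
  have hXP : Xᵀ * P = P * X := by
    rw [← hσX, ← Matrix.mul_assoc, ← Matrix.mul_assoc, hPP, Matrix.one_mul, hσX]
  have hfac : sym V = (S * X)ᵀ * (S * X) := by
    have hS' : Sᵀ * S = P := by
      rw [hS, star_eq_conjTranspose, conjTranspose_eq_transpose_of_trivial]
    rw [transpose_mul, Matrix.mul_assoc, ← Matrix.mul_assoc Sᵀ, hS', ← Matrix.mul_assoc, hXP,
      Matrix.mul_assoc, hsq, hPq]
  have hleft : ∑ ij : Fin d × Fin d, V ij * (y ij.1 * y ij.2) = y ⬝ᵥ (sym V) *ᵥ y := by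
    rw [dotProduct_mulVec_eq_sum, Fintype.sum_prod_type]
    have hswap : ∑ i, ∑ j, V (i, j) * (y i * y j) = ∑ i, ∑ j, V (j, i) * (y i * y j) := by
      rw [Finset.sum_comm]
      exact Finset.sum_congr rfl fun i _ => Finset.sum_congr rfl fun j _ => by ring
    have h2 : ∑ i, ∑ j, y i * y j * sym V i j =
        (∑ i, ∑ j, V (i, j) * (y i * y j) + ∑ i, ∑ j, V (j, i) * (y i * y j)) / 2 := by
      rw [← Finset.sum_add_distrib, Finset.sum_div]
      refine Finset.sum_congr rfl fun i _ => ?_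
      rw [← Finset.sum_add_distrib, Finset.sum_div]
      refine Finset.sum_congr rfl fun j _ => ?_
      simp only [hsym, LinearMap.coe_mk, AddHom.coe_mk, of_apply]
      ring
    rw [h2, ← hswap]
    ring
  rw [hleft, hfac, ← mulVec_mulVec, dotProduct_mulVec, vecMul_transpose, dotProduct]
  refine Finset.sum_congr rfl fun k _ => ?_
  rw [← sq, mulVec, dotProduct]
  simp_rw [haV]

end

end KernelSOS

namespace KernelSOS

open Filter Topology

/-! ### Sum-of-squares decomposition -/

section SOS

variable {d : ℕ} {Ω : Set (EuclideanSpace ℝ (Fin d))}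
  {H : Type*} [NormedAddCommGroup H] [InnerProductSpace ℝ H] [CompleteSpace H] [RKHS ℝ H Ω ℝ]
  {m : ℕ} {M D : ℝ}

theorem IsRich.comp_mem_fintype (hH : IsRich H m M D) {ι : Type*} [Fintype ι] {a : (ι → ℝ) → ℝ}
    (ha : ContDiff ℝ ∞ a) (v : ι → H) : ∃ u : H, ∀ x : Ω, u x = a fun j => v j x := by
  set e := Fintype.equivFin ι
  obtain ⟨u, hu⟩ := hH.comp_mem (Fintype.card ι) (fun w => a fun j => w (e j))
    (ha.comp (contDiff_pi.2 fun j => contDiff_apply ℝ ℝ (e j))) fun i => v (e.symm i)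
  exact ⟨u, fun x => by simp [hu]⟩

theorem iteratedFDeriv_two_const_eq_sum (f : EuclideanSpace ℝ (Fin d) → ℝ) (z y : EuclideanSpace ℝ (Fin d)) :
    (iteratedFDeriv ℝ 2 f z fun _ => y) =
      ∑ ij : Fin d × Fin d, partialDeriv ![ij.1, ij.2] f z * (y ij.1 * y ij.2) := by
  rw [multilinear_const_eq_sum, ← (finTwoArrowEquiv (Fin d)).symm.sum_comp]
  refine Finset.sum_congr rfl fun ij _ => ?_
  simp [partialDeriv, finTwoArrowEquiv, mul_comm]

theorem continuous_partialDeriv {f : EuclideanSpace ℝ (Fin d) → ℝ} {k : ℕ} (hf : ContDiff ℝ k f)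
    (I : Fin k → Fin d) : Continuous (partialDeriv I f) :=
  (ContinuousMultilinearMap.apply ℝ (fun _ : Fin k => EuclideanSpace ℝ (Fin d)) ℝ
    (fun j => EuclideanSpace.single (I j) 1)).continuous.comp
    (hf.continuous_iteratedFDeriv (m := k) le_rfl)

/-- Near a nondegenerate minimizer `f - f z` is a sum of `d` squares of functions of the space:
in the integral form of the Taylor remainder the matrix of the quadratic form is close to half
the Hessian, hence has a smooth factorization. -/
theorem exists_local_sum_squares (hH : IsRich H m M D) (hΩ : IsOpen Ω)
    {f : EuclideanSpace ℝ (Fin d) → ℝ} (hf : ContDiff ℝ 2 f) (hfH : IsAnalyticFor H f)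
    {z : EuclideanSpace ℝ (Fin d)} (hzΩ : z ∈ Ω) (hz : fderiv ℝ f z = 0)
    (hpos : (hessian f z).PosDef) :
    ∃ w : Fin d → H, ∃ ε > 0, ∀ x : Ω, (x : EuclideanSpace ℝ (Fin d)) ∈ Metric.ball z ε →
      f x - f z = ∑ k, (w k x) ^ 2 := by
  obtain ⟨ρ, hρ, hball⟩ := Metric.isOpen_iff.1 hΩ z hzΩ
  choose u hu using fun ij : Fin d × Fin d => hfH.partial_mem ij.1 ij.2
  choose g hg using fun ij => hH.integral_mem z ρ hρ hball (u ij)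
  have hseg : ∀ x ∈ Metric.ball z ρ, ∀ t ∈ Set.uIcc (0 : ℝ) 1, z + t • (x - z) ∈ Ω := by
    intro x hx t ht
    rw [Set.uIcc_of_le zero_le_one] at ht
    refine hball ?_
    rw [mem_ball_iff_norm, add_sub_cancel_left, norm_smul, Real.norm_of_nonneg ht.1]
    have := mem_ball_iff_norm.1 hx
    nlinarith [norm_nonneg (x - z), ht.2]
  have hg' : ∀ ij, ∀ x : Ω, (x : EuclideanSpace ℝ (Fin d)) ∈ Metric.ball z ρ →
      g ij x = ∫ t in (0 : ℝ)..1, (1 - t) *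
        partialDeriv ![ij.1, ij.2] f (z + t • ((x : EuclideanSpace ℝ (Fin d)) - z)) := by
    intro ij x hx
    rw [hg ij x hx]
    refine intervalIntegral.integral_congr fun t ht => ?_
    simp only [zeroExt_of_mem _ (hseg x hx t ht), hu]
  have hcont : ∀ ij : Fin d × Fin d, ∀ v : EuclideanSpace ℝ (Fin d),
      Continuous fun t : ℝ => (1 - t) * partialDeriv ![ij.1, ij.2] f (z + t • v) := fun ij v =>
    (continuous_const.sub continuous_id).mul
      ((continuous_partialDeriv hf _).comp (by fun_prop))
  have hquad : ∀ x : Ω, (x : EuclideanSpace ℝ (Fin d)) ∈ Metric.ball z ρ →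
      f x - f z = ∑ ij : Fin d × Fin d, g ij x *
        (((x : EuclideanSpace ℝ (Fin d)) - z) ij.1 * ((x : EuclideanSpace ℝ (Fin d)) - z) ij.2) := by
    intro x hx
    rw [sub_eq_integral_of_critical hf hz]
    simp_rw [iteratedFDeriv_two_const_eq_sum, Finset.mul_sum, hg' _ x hx, ← intervalIntegral.integral_mul_const]
    rw [← intervalIntegral.integral_finsetSum]
    · refine intervalIntegral.integral_congr fun t _ => Finset.sum_congr rfl fun ij _ => ?_
      ring
    · intro ij _
      exact ((hcont ij _).mul continuous_const).intervalIntegrable _ _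
  set z' : Ω := ⟨z, hzΩ⟩
  have hgz : ∀ ij, g ij z' = ((1 / 2 : ℝ) • hessian f z) ij.1 ij.2 := by
    intro ij
    rw [hg' ij z' (Metric.mem_ball_self hρ)]
    have h1 : ∫ t in (0 : ℝ)..1, (1 - t) = 1 / 2 := by
      rw [intervalIntegral.integral_sub (by simp) (by simp)]
      norm_num
    simp only [z', sub_self, smul_zero, add_zero]
    rw [intervalIntegral.integral_mul_const, h1]
    simp [hessian]
  obtain ⟨a, ha, haV⟩ := exists_smooth_squares (hpos.smul (by norm_num : (0 : ℝ) < 1 / 2))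
  have htend : Tendsto (fun x : Ω => fun ij => g ij x) (𝓝 z')
      (𝓝 fun ij : Fin d × Fin d => ((1 / 2 : ℝ) • hessian f z) ij.1 ij.2) := by
    have : Continuous fun x : Ω => fun ij => g ij x :=
      continuous_pi fun ij => hH.continuous_coe hΩ (g ij)
    have := this.tendsto z'
    simpa only [hgz] using this
  obtain ⟨δ, hδ, hnear⟩ := Metric.eventually_nhds_iff.1 (htend.eventually haV)
  choose c hc using fun l : Fin d => hH.smooth_mem (fun x => (x - z) l) (by fun_prop)
  choose w hw using fun k => hH.comp_mem_fintype (ι := (Fin d × Fin d) ⊕ Fin d)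
    (a := fun W => ∑ l, a k l (fun ij => W (Sum.inl ij)) * W (Sum.inr l))
    (ContDiff.sum fun l _ => ((ha k l).comp
      (contDiff_pi.2 fun ij => contDiff_apply ℝ ℝ (Sum.inl ij))).mul
        (contDiff_apply ℝ ℝ (Sum.inr l))) (Sum.elim g c)
  refine ⟨w, min ρ δ, lt_min hρ hδ, fun x hx => ?_⟩
  rw [hquad x (Metric.ball_subset_ball (min_le_left _ _) hx),
    hnear (y := x) (lt_of_lt_of_le hx (min_le_right _ _))]
  refine Finset.sum_congr rfl fun k _ => ?_
  simp [hw, hc]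

/-- A smooth function equal to `√(t - c)` for `t ≥ c + ε`. -/
theorem exists_smooth_sqrt (c : ℝ) {ε : ℝ} (hε : 0 < ε) :
    ∃ a : ℝ → ℝ, ContDiff ℝ ∞ a ∧ ∀ t, ε ≤ t - c → a t ^ 2 = t - c := by
  refine ⟨fun t => √(t - c) * Real.smoothTransition (2 * (t - c) / ε - 1),
    contDiff_iff_contDiffAt.2 fun t => ?_, fun t ht => ?_⟩
  · by_cases ht : 0 < t - c
    · refine ContDiffAt.mul ?_ ?_
      · exact (contDiffAt_id.sub contDiffAt_const).sqrt ht.ne'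
      · exact Real.smoothTransition.contDiff.contDiffAt.comp t (by fun_prop)
    · refine (contDiffAt_const (c := (0 : ℝ))).congr_of_eventuallyEq ?_
      have : ∀ᶠ s in 𝓝 t, s < c + ε / 2 := eventually_lt_nhds (by linarith)
      filter_upwards [this] with s hs
      rw [Real.smoothTransition.zero_of_nonpos, mul_zero]
      rw [sub_nonpos, div_le_one hε]
      linarith
  · beta_reduce
    rw [Real.smoothTransition.one_of_one_le, mul_one, Real.sq_sqrt (hε.le.trans ht)]
    rw [le_sub_iff_add_le, le_div_iff₀ hε]
    linarith

/-- Splitting off the squares at finitely many minimizers with trigonometric cutoffs: what remains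
is multiplied by the square of a smooth function that vanishes near these minimizers. -/
theorem exists_sum_squares_add_remainder (hH : IsRich H m M D)
    {F : Ω → ℝ} {s : Finset (EuclideanSpace ℝ (Fin d))}
    (hF : ∀ z ∈ s, ∃ w : Fin d → H, ∃ ε > 0, ∀ x : Ω,
      (x : EuclideanSpace ℝ (Fin d)) ∈ Metric.ball z ε → F x = ∑ k, (w k x) ^ 2) :
    ∃ (v : EuclideanSpace ℝ (Fin d) → Fin d → H) (β : EuclideanSpace ℝ (Fin d) → ℝ),
      ContDiff ℝ ∞ β ∧ (∀ z ∈ s, β =ᶠ[𝓝 z] 0) ∧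
      ∀ x : Ω, F x = ∑ z ∈ s, ∑ k, (v z k x) ^ 2 + β x ^ 2 * F x := by
  classical
  induction s using Finset.induction_on with
  | empty => exact ⟨fun _ _ => 0, fun _ => 1, contDiff_const, by simp, by simp⟩
  | insert z s hzs ih =>
    obtain ⟨v, β, hβ, hβ0, hv⟩ := ih fun y hy => hF y (Finset.mem_insert_of_mem hy)
    obtain ⟨w, ε, hε, hw⟩ := hF z (Finset.mem_insert_self _ _)
    -- The factor `β²` is split into `β² sin² θ`, supported near `z`, and `β² cos² θ`, zero near `z`.
    set χ : ContDiffBump z := ⟨ε / 2, ε, by positivity, by linarith⟩ with hχ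
    set θ : EuclideanSpace ℝ (Fin d) → ℝ := fun x => Real.pi / 2 * χ x with hθ
    have hθc : ContDiff ℝ ∞ θ := contDiff_const.mul χ.contDiff
    obtain ⟨b, hb⟩ := hH.smooth_mem (fun x => β x * Real.sin (θ x))
      (hβ.mul (Real.contDiff_sin.comp hθc))
    choose p hp using fun k => hH.mul_mem b (w k)
    refine ⟨fun y => if y = z then p else v y, fun x => β x * Real.cos (θ x),
      hβ.mul (Real.contDiff_cos.comp hθc), fun y hy => ?_, fun x => ?_⟩
    · rcases Finset.mem_insert.1 hy with rfl | hy
      · filter_upwards [χ.eventuallyEq_one] with x hx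
        simp [hθ, hx]
      · filter_upwards [hβ0 y hy] with x hx
        simp [hx]
    · have hs : ∑ y ∈ s, ∑ k, ((if y = z then p else v y) k x) ^ 2 =
          ∑ y ∈ s, ∑ k, (v y k x) ^ 2 := by
        refine Finset.sum_congr rfl fun y hy => ?_
        rw [if_neg (ne_of_mem_of_not_mem hy hzs)]
      beta_reduce
      rw [Finset.sum_insert hzs, hs, if_pos rfl]
      have hpk : ∑ k, (p k x) ^ 2 = (β x * Real.sin (θ x)) ^ 2 * F x := by
        simp_rw [fun k => (hp k).1 x, hb, mul_pow _ (_ : ℝ) 2]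
        rw [← Finset.mul_sum]
        by_cases hx : (x : EuclideanSpace ℝ (Fin d)) ∈ Metric.ball z ε
        · rw [hw x hx]
        · have : χ (x : EuclideanSpace ℝ (Fin d)) = 0 :=
            χ.zero_of_le_dist (not_lt.1 hx)
          simp [hθ, this]
      rw [hpk]
      have h1 := Real.sin_sq_add_cos_sq (θ x)
      have h2 := hv x
      have h3 : β x ^ 2 * F x = (β x * Real.sin (θ x)) ^ 2 * F x +
          (β x * Real.cos (θ x)) ^ 2 * F x := by
        rw [mul_pow, mul_pow, ← add_mul, ← mul_add, h1, mul_one]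
      linarith

/-- `f - min f` is a sum of `d |Z| + 1` squares: `d` for each minimizer, and the square of a smooth
function of `f` times a cutoff, which covers the region where `f - min f` is bounded below. -/
theorem exists_sum_squares (hH : IsRich H m M D) {r : ℝ} (hΩ : IsUnionOfBalls Ω r)
    {f : EuclideanSpace ℝ (Fin d) → ℝ} (hf : IsGeometric Ω f) (hfH : IsAnalyticFor H f)
    {c : ℝ} (hc : ∀ z ∈ minimizersIn Ω f, f z = c) :
    ∃ w : Option (hf.finite.toFinset × Fin d) → H, ∀ x : Ω, f x - c = ∑ i, (w i x) ^ 2 := by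
  classical
  have hΩo := hΩ.isOpen
  obtain ⟨v, β, hβ, hβ0, hv⟩ := exists_sum_squares_add_remainder hH (F := fun x : Ω => f x - c)
    (s := hf.finite.toFinset) fun z hz => by
      have hz' := hf.finite.mem_toFinset.1 hz
      rw [← hc z hz']
      exact exists_local_sum_squares hH hΩo hf.contDiff hfH hz'.1
        (IsLocalMin.fderiv_eq_zero (Eventually.of_forall hz'.2)) (hf.hessian_posDef z hz')
  obtain ⟨z₀, hz₀⟩ := hf.nonempty
  have hmin : ∀ x, c ≤ f x := fun x => by rw [← hc z₀ hz₀]; exact hz₀.2 x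
  -- Away from the zero set of the cutoff, `f - c` is bounded below by a positive constant.
  obtain ⟨ε, hε, hεK⟩ : ∃ ε > 0, ∀ x ∈ closure Ω \ interior {x | β x = 0}, ε ≤ f x - c := by
    have hK : IsCompact (closure Ω \ interior {x | β x = 0}) :=
      hΩ.isBounded.isCompact_closure.diff isOpen_interior
    have hpos : ∀ x ∈ closure Ω \ interior {x | β x = 0}, 0 < f x - c := by
      rintro x ⟨hxΩ, hxβ⟩
      refine sub_pos.2 (lt_of_le_of_ne (hmin x) fun hxc => ?_)
      have hxmin : ∀ y, f x ≤ f y := fun y => by rw [← hxc]; exact hmin y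
      by_cases hx : x ∈ Ω
      · exact hxβ (mem_interior_iff_mem_nhds.2
          (hβ0 x (hf.finite.mem_toFinset.2 ⟨hx, hxmin⟩)))
      · exact hf.frontier x ⟨hxΩ, by rwa [hΩo.interior_eq]⟩ hxmin
    rcases (closure Ω \ interior {x | β x = 0}).eq_empty_or_nonempty with h | h
    · exact ⟨1, one_pos, by simp [h]⟩
    · obtain ⟨x, hx, hmin⟩ := hK.exists_isMinOn h
        (hf.contDiff.continuous.sub (continuous_const (y := c))).continuousOn
      exact ⟨f x - c, hpos x hx, fun y hy => hmin hy⟩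
  obtain ⟨a, ha, hasq⟩ := exists_smooth_sqrt c hε
  obtain ⟨uβ, huβ⟩ := hH.smooth_mem β hβ
  obtain ⟨uf, huf⟩ := hfH.mem
  obtain ⟨q, hq⟩ := hH.comp_mem_fintype (ι := Fin 2) (a := fun W => W 0 * a (W 1))
    ((contDiff_apply ℝ ℝ 0).mul (ha.comp (contDiff_apply ℝ ℝ 1))) ![uβ, uf]
  refine ⟨fun o => o.elim q fun i => v i.1 i.2, fun x => ?_⟩
  rw [Fintype.sum_option, Fintype.sum_prod_type]
  simp only [Option.elim]
  rw [Finset.sum_coe_sort hf.finite.toFinset fun z => ∑ k, (v z k x) ^ 2]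
  have hqx : (q x) ^ 2 = β x ^ 2 * (f x - c) := by
    rw [hq]
    simp only [Matrix.cons_val_zero, Matrix.cons_val_one, huβ, huf]
    rw [mul_pow]
    by_cases hx : (x : EuclideanSpace ℝ (Fin d)) ∈ interior {x | β x = 0}
    · have : (x : EuclideanSpace ℝ (Fin d)) ∈ {x | β x = 0} := interior_subset hx
      rw [Set.mem_ofPred_eq] at this
      simp [this]
    · rw [hasq _ (hεK _ ⟨subset_closure x.2, hx⟩)]
  rw [hqx, add_comm]
  exact hv x

end SOS

/-! ### Finite sums of rank one operators -/

section RankOne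

variable {H : Type*} [NormedAddCommGroup H] [InnerProductSpace ℝ H] {ι : Type*} [Fintype ι]

/-- The operator `∑ w i ⊗ w i`. -/
noncomputable def sumRankOne (w : ι → H) : H →L[ℝ] H :=
  ∑ i, InnerProductSpace.rankOne ℝ (w i) (w i)

theorem isPositive_sumRankOne (w : ι → H) : (sumRankOne w).IsPositive :=
  ContinuousLinearMap.isPositive_sum _ fun _ _ => InnerProductSpace.isPositive_rankOne_self _

theorem inner_sumRankOne (w : ι → H) (v : H) : ⟪v, sumRankOne w v⟫ = ∑ i, ⟪w i, v⟫ ^ 2 := by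
  rw [sumRankOne, sum_apply, inner_sum]
  refine Finset.sum_congr rfl fun i _ => ?_
  rw [InnerProductSpace.rankOne_apply, inner_smul_right, real_inner_comm, sq]

theorem hasFiniteTrace_sumRankOne [CompleteSpace H] (w : ι → H) :
    HasFiniteTrace (sumRankOne w) := by
  simp_rw [HasFiniteTrace, inner_sumRankOne]
  refine summable_sum fun i _ => ?_
  refine ((someBasis H).summable_inner_mul_inner (w i) (w i)).congr fun j => ?_
  rw [sq, real_inner_comm (w i) (someBasis H j)]

theorem rank_sumRankOne_le (w : ι → H) :
    LinearMap.rank (sumRankOne w : H →ₗ[ℝ] H) ≤ Fintype.card ι := by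
  classical
  have hle : LinearMap.range (sumRankOne w : H →ₗ[ℝ] H) ≤
      Submodule.span ℝ ((Finset.univ.image w : Finset H) : Set H) := by
    rintro _ ⟨v, rfl⟩
    rw [ContinuousLinearMap.coe_coe, sumRankOne, sum_apply]
    refine Submodule.sum_mem _ fun i _ => ?_
    rw [InnerProductSpace.rankOne_apply]
    exact Submodule.smul_mem _ _ (Submodule.subset_span (by simp))
  refine (Submodule.rank_mono hle).trans ((rank_span_finset_le _).trans ?_)
  exact_mod_cast Finset.card_image_le

end RankOne

end KernelSOS

namespace KernelSOS

/-! ### Optimality and error bounds -/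

section Bounds

variable {d : ℕ} {Ω : Set (EuclideanSpace ℝ (Fin d))}
  {H : Type*} [NormedAddCommGroup H] [InnerProductSpace ℝ H] [CompleteSpace H] [RKHS ℝ H Ω ℝ]
  {m : ℕ} {M D : ℝ} {f : EuclideanSpace ℝ (Fin d) → ℝ}

theorem iInf_eq_of_mem_minimizersIn {z : EuclideanSpace ℝ (Fin d)} (hz : z ∈ minimizersIn Ω f) :
    ⨅ y, f y = f z :=
  le_antisymm (ciInf_le ⟨f z, by rintro _ ⟨y, rfl⟩; exact hz.2 y⟩ z) (le_ciInf hz.2)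

theorem IsFeasible.le_apply {c : ℝ} {A : H →L[ℝ] H} (h : IsFeasible H f c A) (x : Ω) :
    c ≤ f x := by
  have := h.1.inner_nonneg_right (feature H x)
  rw [← h.2] at this
  linarith

theorem exists_isSolution (hH : IsRich H m M D) {r : ℝ} (hΩ : IsUnionOfBalls Ω r)
    (hf : IsGeometric Ω f) (hfH : IsAnalyticFor H f) :
    ∃ A : H →L[ℝ] H, IsSolution H f (⨅ z, f z) A ∧ HasFiniteTrace A ∧
      LinearMap.rank (A : H →ₗ[ℝ] H) ≤ ((d * (minimizersIn Ω f).ncard + 1 : ℕ) : Cardinal) := by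
  obtain ⟨w, hw⟩ := exists_sum_squares hH hΩ hf hfH fun z hz => (iInf_eq_of_mem_minimizersIn hz).symm
  obtain ⟨z, hz⟩ := hf.nonempty
  refine ⟨sumRankOne w, ⟨⟨isPositive_sumRankOne w, fun x => ?_⟩, fun c' A' h' => ?_⟩,
    hasFiniteTrace_sumRankOne w, (rank_sumRankOne_le w).trans_eq ?_⟩
  · rw [inner_sumRankOne, hw]
    simp_rw [inner_feature]
  · rw [iInf_eq_of_mem_minimizersIn hz]
    exact h'.le_apply ⟨z, hz.1⟩
  · rw [Fintype.card_option, Fintype.card_prod, Fintype.card_coe, Fintype.card_fin,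
      Set.ncard_eq_toFinset_card _ hf.finite, mul_comm]

theorem IsSolution.eq_iInf (hH : IsRich H m M D) {r : ℝ} (hΩ : IsUnionOfBalls Ω r)
    (hf : IsGeometric Ω f) (hfH : IsAnalyticFor H f) {c : ℝ} {A : H →L[ℝ] H}
    (h : IsSolution H f c A) : c = ⨅ z, f z := by
  obtain ⟨A', hA', -⟩ := exists_isSolution hH hΩ hf hfH
  exact le_antisymm (hA'.2 c A h.1) (h.2 _ A' hA'.1)

theorem constC_mul_pow_nonneg (hm : 0 < m) {n : ℕ} (hn : 0 < n) (hΩ : Bornology.IsBounded Ω)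
    {z : EuclideanSpace ℝ (Fin d)} (hz : z ∈ Ω) (x : Fin n → Ω) :
    0 ≤ constC d m * fillDistance Ω x ^ m := by
  refine mul_nonneg ?_ (pow_nonneg ((norm_nonneg _).trans
    (exists_norm_sub_le_fillDistance hn hΩ x hz).choose_spec) m)
  rw [constC_eq d hm]
  positivity

/-- The value of the semidefinite program exceeds the minimum by at most a sampling error. -/
theorem IsSDPFeasible.sub_iInf_le (hH : IsRich H m M D) (hd : 0 < d) (hm : 0 < m) {r : ℝ}
    (hΩ : IsUnionOfBalls Ω r) (hf : IsGeometric Ω f) (hfH : IsAnalyticFor H f) {n : ℕ} (hn : 0 < n)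
    {x : Fin n → Ω} (hh : fillDistance Ω x ≤ r / max 1 (18 * ((m : ℝ) - 1) ^ 2))
    {R : Matrix (Fin n) (Fin n) ℝ} (hR : IsCholesky (kernelMatrix H x) R) {c : ℝ}
    {B : Matrix (Fin n) (Fin n) ℝ} (hB : IsSDPFeasible f x R c B) :
    c - ⨅ z, f z ≤
      constC d m * fillDistance Ω x ^ m * (seminormOn Ω m f + D * (M * B.trace)) := by
  obtain ⟨z, hz⟩ := hf.nonempty
  obtain ⟨w, hw0, hwx, hwn⟩ := hH.exists_eq_quadratic hR hB.1
  have h := hH.abs_sub_le_of_eq_at_sites hd hm hΩ hn x hh hfH.mem (c := c) (w := w)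
    (fun i => (hB.2 i).trans (hwx i).symm) ⟨z, hz.1⟩
  have hη := constC_mul_pow_nonneg hm hn hΩ.isBounded hz.1 x
  have hD : 0 ≤ D := zero_le_one.trans hH.one_le_D
  rw [iInf_eq_of_mem_minimizersIn hz]
  calc c - f z ≤ |f z - c - w ⟨z, hz.1⟩| := by
        rw [abs_sub_comm]
        linarith [le_abs_self (w ⟨z, hz.1⟩ - (f z - c)), hw0 ⟨z, hz.1⟩]
    _ ≤ constC d m * fillDistance Ω x ^ m * (seminormOn Ω m f + D * ‖w‖) := h
    _ ≤ _ := by gcongr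

end Bounds

end KernelSOS

open KernelSOS in
theorem mainTheorem3 {d : ℕ} (hd : 0 < d)
    (Ω : Set (EuclideanSpace ℝ (Fin d))) (r : ℝ) (hΩ : IsUnionOfBalls Ω r)
    (n : ℕ) (hn : 0 < n) (x : Fin n → Ω) (hx : Function.Injective x)
    (H : Type*) [NormedAddCommGroup H] [InnerProductSpace ℝ H] [CompleteSpace H] [RKHS ℝ H Ω ℝ]
    (m : ℕ) (hm : 0 < m) (M D : ℝ) (hH : IsRich H m M D)
    (f : EuclideanSpace ℝ (Fin d) → ℝ) (hf : IsGeometric Ω f) (hfH : IsAnalyticFor H f) :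
    (∃ A : H →L[ℝ] H, IsSolution H f (⨅ z, f z) A ∧ HasFiniteTrace A ∧
      LinearMap.rank (A : H →ₗ[ℝ] H) ≤ ((d * (minimizersIn Ω f).ncard + 1 : ℕ) : Cardinal)) ∧
    (∃ R, IsCholesky (kernelMatrix H x) R) ∧
    ∀ R, IsCholesky (kernelMatrix H x) R → ∀ lam : ℝ, 0 < lam →
      (∃ c B, IsSDPSolution f x R lam c B) ∧
      ∀ c B, IsSDPSolution f x R lam c B →
        fillDistance Ω x ≤ r / max 1 (18 * ((m : ℝ) - 1) ^ 2) →
        2 * M * D * (constC d m * fillDistance Ω x ^ m) ≤ lam →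
        ∀ (cs : ℝ) (A : H →L[ℝ] H), IsSolution H f cs A → HasFiniteTrace A →
          |c - ⨅ z, f z| ≤
              2 * (constC d m * fillDistance Ω x ^ m) * seminormOn Ω m f + lam * opTrace A ∧
          B.trace ≤ 2 * opTrace A +
              2 * ((constC d m * fillDistance Ω x ^ m) / lam) * seminormOn Ω m f := by
  refine ⟨exists_isSolution hH hΩ hf hfH, exists_isCholesky (hH.linearIndependent_feature hx),
    fun R hR lam hlam => ⟨exists_isSDPSolution hn hR.isUnit_det f x hlam,
      fun c B hB hh hηlam cs A hA hfin => ?_⟩⟩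
  set η := constC d m * fillDistance Ω x ^ m with hη
  set S := seminormOn Ω m f with hS
  obtain rfl := hA.eq_iInf hH hΩ hf hfH
  obtain ⟨B', hB', htr⟩ := hA.1.exists_isSDPFeasible hfin hR
  have h1 := hB.2 _ _ hB'
  have h2 : lam * B'.trace ≤ lam * opTrace A := by gcongr
  have h3 := hB.1.sub_iInf_le hH hd hm hΩ hf hfH hn hh hR
  rw [← hη, ← hS] at h3
  -- The constraint on `lam` lets the trace term of the sampling error be absorbed.
  have hBtr : 0 ≤ B.trace := (abs_nonneg _).trans (hB.1.1.abs_apply_le_trace ⟨0, hn⟩ ⟨0, hn⟩)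
  have h4 : η * (D * (M * B.trace)) ≤ lam / 2 * B.trace := by
    have := mul_le_mul_of_nonneg_right hηlam hBtr
    linarith
  have h5 : 0 ≤ lam * B.trace := by positivity
  have h6 : lam / 2 * B.trace ≤ η * S + lam * opTrace A := by linarith
  have h7 : 0 ≤ η * S := mul_nonneg (constC_mul_pow_nonneg hm hn hΩ.isBounded (x ⟨0, hn⟩).2 x)
    (Real.iSup_nonneg fun _ => Real.iSup_nonneg fun _ => abs_nonneg _)
  refine ⟨abs_le.2 ⟨?_, by linarith⟩, ?_⟩
  · linarith
  · have e : 2 * opTrace A + 2 * (η / lam) * S = (2 * (η * S + lam * opTrace A)) / lam := by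
      field_simp
      ring
    rw [e, le_div_iff₀ hlam]
    linarith
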